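/- Let $X$ be a complex Hilbert space and let $A : D(A) \subset X \to X$ be a maximal accretive operator, i.e. a densely defined linear operator with $\operatorname{Re}\langle Au,u\rangle \ge 0$ for all $u \in D(A)$ which has no proper extension with the same property. Assume that the numerical range $\{\langle Au,u\rangle : u \in D(A),\ \|u\| = 1\}$ is contained in the closed sector $\{z \in \mathbb{C} : |\arg z| \le \frac{\pi}{2} - 2\alpha\}$ (vertex $0$ included) for some $\alpha \in (0, \frac{\pi}{4}]$, and that $A$ is invertible (with bounded inverse). Then $-A$ generates a strongly continuous semigroup $(e^{-tA})_{t \ge 0}$ on $X$, and the quantities $$\Sigma = \inf \operatorname{Re}(\sigma(A)) \in (-\infty, +\infty], \qquad \Psi = \Bigl(\sup_{\lambda \in \mathbb{R}} \|(A - i\lambda)^{-1}\|\Bigr)^{-1} \in [0, +\infty]$$ satisfy $\Sigma > 0$ and $\Psi > 0$ (with $\Sigma = +\infty$ if $\sigma(A) = \emptyset$, and $\Psi = +\infty$ if $X = \{0\}$). For $\mu > 0$ let $N(A,\mu) = \sup_{\lambda \in \mathbb{R}} \|(A - \mu - i\lambda)^{-1}\| \in [0, +\infty]$, where the norm is $+\infty$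 if $\mu + i\lambda \in \sigma(A)$. Then the following holds. - (i) If there exist $C \ge 1$ and $\mu > 0$ such that $\|e^{-tA}\| \le C e^{-\mu t}$ for all $t \ge 0$, then $\Sigma \ge \mu$ and $\Psi \ge \dfrac{\mu}{1 + \log C}$. - (ii) For every $\mu \in (0, \Sigma)$ one has $N(A,\mu) < \infty$ and $$\|e^{-tA}\| \le C(A,\mu)\, e^{-\mu t} \quad \text{for all } t \ge 0, \qquad \text{where } C(A,\mu) = \frac{1}{\pi \tan \alpha}\bigl(\mu N(A,\mu) + 2\pi\bigr).$$ - (iii) For every $\mu \in (0, \Psi)$ one has $N(A,\mu) \le (\Psi - \mu)^{-1}$ (with the convention $(+\infty)^{-1} = 0$). -/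

import Mathlib

open Filter Topology
open scoped ENNReal

noncomputable section

namespace LinearPMap

variable {X : Type*} [NormedAddCommGroup X] [InnerProductSpace ℂ X]

/-- The numerical range `{⟨A u, u⟩ ; u ∈ D(A), ‖u‖ = 1}`. Mathlib's inner product is linear in its
second argument, so the scalar product `⟨A u, u⟩`, linear in `A u`, is `inner ℂ u (A u)`. -/
def numericalRange (A : X →ₗ.[ℂ] X) : Set ℂ :=
  {z | ∃ u : A.domain, ‖(u : X)‖ = 1 ∧ inner ℂ (u : X) (A u) = z}

/-- `A` is accretive: `Re ⟨A u, u⟩ ≥ 0` on the domain of `A`. -/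
def IsAccretive (A : X →ₗ.[ℂ] X) : Prop :=
  ∀ u : A.domain, 0 ≤ (inner ℂ (u : X) (A u)).re

/-- `A` is maximal accretive: it is densely defined and accretive, and it has no proper accretive
extension (`A ≤ B` says that `B` extends `A`). -/
structure IsMaximalAccretive (A : X →ₗ.[ℂ] X) : Prop where
  dense_domain : Dense (A.domain : Set X)
  accretive : A.IsAccretive
  maximal : ∀ B : X →ₗ.[ℂ] X, B.IsAccretive → A ≤ B → B = A

/-- The bounded everywhere defined operator `R` is the two-sided inverse of
`A - z : D(A) → X`. -/
structure IsResolventAt (A : X →ₗ.[ℂ] X) (z : ℂ) (R : X →L[ℂ] X) : Prop where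
  right_inv : ∀ y : X, ∃ h : R y ∈ A.domain, A ⟨R y, h⟩ - z • R y = y
  left_inv : ∀ u : A.domain, R (A u - z • (u : X)) = u

/-- The resolvent set of an unbounded operator. -/
def resolventSet (A : X →ₗ.[ℂ] X) : Set ℂ :=
  {z | ∃ R : X →L[ℂ] X, A.IsResolventAt z R}

/-- The spectrum of an unbounded operator. -/
def spectrum (A : X →ₗ.[ℂ] X) : Set ℂ :=
  A.resolventSetᶜ

open Classical in
/-- The resolvent `(A - z)⁻¹` (with value `0` outside of the resolvent set). -/
def resolvent (A : X →ₗ.[ℂ] X) (z : ℂ) : X →L[ℂ] X :=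
  if h : ∃ R : X →L[ℂ] X, A.IsResolventAt z R then h.choose else 0

open Classical in
/-- The norm `‖(A - z)⁻¹‖ ∈ [0, ∞]`, with the usual convention that it is `∞` when `z` belongs to
the spectrum. -/
def resolventNorm (A : X →ₗ.[ℂ] X) (z : ℂ) : ℝ≥0∞ :=
  if z ∈ A.resolventSet then ‖A.resolvent z‖ₑ else ⊤

/-- `Σ = inf Re σ(A)`, an extended real number (it is `+∞` when the spectrum is empty). -/
def spectralAbscissa (A : X →ₗ.[ℂ] X) : EReal :=
  ⨅ z ∈ A.spectrum, (z.re : EReal)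

/-- `N(A, μ) = sup {‖(A - μ - iλ)⁻¹‖ ; λ ∈ ℝ}`, in `[0, ∞]`. -/
def lineResolventBound (A : X →ₗ.[ℂ] X) (μ : ℝ) : ℝ≥0∞ :=
  ⨆ l : ℝ, A.resolventNorm ((μ : ℂ) + Complex.I * (l : ℂ))

/-- `Ψ = (sup {‖(A - iλ)⁻¹‖ ; λ ∈ ℝ})⁻¹`, in `[0, ∞]`. -/
def pseudospectralAbscissa (A : X →ₗ.[ℂ] X) : ℝ≥0∞ :=
  (⨆ l : ℝ, A.resolventNorm (Complex.I * (l : ℂ)))⁻¹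

/-- `T` (restricted to `t ≥ 0`) is a strongly continuous one-parameter semigroup of bounded
operators, and its infinitesimal generator is exactly `-A`: a vector `x` belongs to `D(A)` with
`A x = y` if and only if `(T t x - x) / t → -y` as `t → 0⁺`. -/
structure IsSemigroupGeneratedByNeg (A : X →ₗ.[ℂ] X) (T : ℝ → X →L[ℂ] X) : Prop where
  map_zero : T 0 = ContinuousLinearMap.id ℂ X
  map_add : ∀ s t : ℝ, 0 ≤ s → 0 ≤ t → T (s + t) = (T s).comp (T t)
  strong_continuity : ∀ x : X, Tendsto (fun t : ℝ => T t x) (𝓝[>] 0) (𝓝 x)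
  generator : ∀ x y : X, (x, y) ∈ A.graph ↔
    Tendsto (fun t : ℝ => (t⁻¹ : ℝ) • (T t x - x)) (𝓝[>] 0) (𝓝 (-y))

open Classical in
/-- The operators `e^{-tA}`, `t ≥ 0`: the strongly continuous semigroup generated by `-A`
(with value `0` if `-A` does not generate one). -/
def expNeg (A : X →ₗ.[ℂ] X) (t : ℝ) : X →L[ℂ] X :=
  if h : ∃ T : ℝ → X →L[ℂ] X, A.IsSemigroupGeneratedByNeg T then h.choose t else 0

end LinearPMap

end

/-!
Since `A` is invertible, everything can be expressed with the bounded operator `B = A⁻¹`: the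
resolvent is `(A - z)⁻¹ = B (1 - z B)⁻¹`, and `x = B y` describes the graph of `A`. Rotating the
numerical range by the angles `φ` with `|φ| ≤ 2 α` keeps it in the right half-plane. Therefore (by
coercivity) every half-plane `Re (e^{iφ} z) < 0` lies in the resolvent set, with the bound
`1 / |Re (e^{iφ} z)|` of the resolvent. With `φ = ± 2 α` this gives `‖(A - z)⁻¹‖ ≤ 1 / (τ |Im z|)`
as soon as `Re z ≤ τ |Im z|`, where `τ = tan α`.

If the half-plane `Re z ≤ μ` is in the resolvent set, `e^{-tA}` is the integral of
`(2πi)⁻¹ e^{-tz} (A - z)⁻¹` along the contour `Re z = max μ (τ |Im z|)`. That these integrals form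
the contraction semigroup generated by `-A` is shown directly for every such `μ`: they solve
`u' = -A u`, they converge to the identity on the domain of `A` as `t → 0`
(`IsAdmissibleContour.tendsto_semigroupIntegral_mul`; this is where the contour has to be moved and
a residue appears), and solutions of `u' = -A u` do not increase in norm because `A` is accretive
(`norm_le_of_hasDerivWithinAt`). The last fact gives the contraction bound, the semigroup law, and
(`IsAdmissibleContour.eq_semigroup`) the uniqueness of the semigroup, so that the contour may be
chosen freely.

The three estimates follow. For (i), the resolvent is the Laplace transform of the semigroup, whose
norm is at most `min 1 (C e^{-μt})`, a function with the integral `(1 + log C) / μ`. For (ii), the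
contour integral is estimated on the segment, of length `2 μ / τ`, and on the two rays when
`μ t ≥ 1 / 2`; for smaller `t` the contraction bound is enough. (iii) is the Neumann series.
-/

namespace SectorialSemigroup

open Set MeasureTheory

/-! ### The resolvent of the inverse of a bounded operator -/

section ResolventOfInverse

variable {𝔸 : Type*} [NormedRing 𝔸] [NormedAlgebra ℂ 𝔸]

/-- If `b` is the inverse of an operator `A`, then `invRes b z` is the resolvent `(A - z)⁻¹`,
written as `b (1 - z b)⁻¹` so that only bounded operators occur. It has the value `0` when
`1 - z b` is not invertible. -/
noncomputable def invRes (b : 𝔸) (z : ℂ) : 𝔸 := b * Ring.inverse (1 - z • b)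

/-- The resolvent set of the (possibly unbounded) inverse of `b`. -/
def invResSet (b : 𝔸) : Set ℂ := {z | IsUnit (1 - z • b)}

variable {b : 𝔸} {z w : ℂ}

theorem zero_mem_invResSet (b : 𝔸) : (0 : ℂ) ∈ invResSet b := by
  simp [invResSet]

theorem invRes_mul_cancel (hz : z ∈ invResSet b) : invRes b z * (1 - z • b) = b := by
  rw [invRes, mul_assoc, Ring.inverse_mul_cancel _ hz, mul_one]

theorem commute_invRes (b : 𝔸) (z : ℂ) : Commute b (invRes b z) := by
  have h : Commute b (1 - z • b) :=
    (Commute.one_right b).sub_right ((Commute.refl b).smul_right z)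
  refine (Commute.refl b).mul_right ?_
  by_cases hu : IsUnit (1 - z • b)
  · obtain ⟨u, hu⟩ := hu
    rw [← hu] at h ⊢
    rw [Ring.inverse_unit]
    exact h.units_inv_right
  · rw [Ring.inverse_non_unit _ hu]
    exact Commute.zero_right b

theorem mul_invRes_cancel (hz : z ∈ invResSet b) : (1 - z • b) * invRes b z = b := by
  have h : Commute (1 - z • b) (invRes b z) :=
    (Commute.one_left _).sub_left ((commute_invRes b z).smul_left z)
  rw [h.eq, invRes_mul_cancel hz]

/-- `A⁻¹ (A - z)⁻¹ = z⁻¹ ((A - z)⁻¹ - A⁻¹)`, without the division. -/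
theorem smul_mul_invRes (hz : z ∈ invResSet b) : z • (b * invRes b z) = invRes b z - b := by
  have := mul_invRes_cancel hz
  rw [sub_mul, one_mul, smul_mul_assoc] at this
  rw [eq_sub_iff_add_eq, ← eq_sub_iff_add_eq', this]

theorem mem_invResSet_of_mul_eq {r : 𝔸} (h₁ : (1 - z • b) * r = b) (h₂ : r * (1 - z • b) = b) :
    z ∈ invResSet b := by
  refine ⟨⟨1 - z • b, 1 + z • r, ?_, ?_⟩, rfl⟩
  · rw [mul_add, mul_smul_comm, h₁]; simp
  · rw [add_mul, smul_mul_assoc, h₂]; simp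

theorem eq_invRes (hz : z ∈ invResSet b) {r : 𝔸} (h : (1 - z • b) * r = b) : r = invRes b z :=
  hz.mul_left_cancel (h.trans (mul_invRes_cancel hz).symm)

/-- The resolvent identity. -/
theorem invRes_sub (hz : z ∈ invResSet b) (hw : w ∈ invResSet b) :
    invRes b z - invRes b w = (z - w) • (invRes b z * invRes b w) := by
  have h1 : invRes b z * ((1 - w • b) * invRes b w) = invRes b z * b := by
    rw [mul_invRes_cancel hw]
  have h2 : (invRes b z * (1 - z • b)) * invRes b w = b * invRes b w := by
    rw [invRes_mul_cancel hz]
  have h3 := mul_invRes_cancel hw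
  have h4 := invRes_mul_cancel hz
  simp only [mul_sub, sub_mul, mul_one, one_mul, smul_mul_assoc, mul_smul_comm,
    mul_assoc] at h1 h2 h3 h4
  rw [← h1, sub_eq_iff_eq_add] at h4
  rw [← h2, sub_eq_iff_eq_add] at h3
  refine (congrArg₂ (· - ·) h4 h3).trans ?_
  module

variable [CompleteSpace 𝔸]

theorem isOpen_invResSet (b : 𝔸) : IsOpen (invResSet b) :=
  Units.isOpen.preimage (by fun_prop : Continuous fun z : ℂ => 1 - z • b)

theorem continuousAt_invRes (hz : z ∈ invResSet b) : ContinuousAt (invRes b) z := by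
  have h : ContinuousAt (fun z : ℂ => 1 - z • b) z := by fun_prop
  obtain ⟨u, hu⟩ := hz
  have h2 : ContinuousAt Ring.inverse (1 - z • b) := hu ▸ NormedRing.inverse_continuousAt u
  exact continuousAt_const.mul (ContinuousAt.comp (f := fun z : ℂ => 1 - z • b) h2 h)

theorem hasDerivAt_invRes (hz : z ∈ invResSet b) :
    HasDerivAt (invRes b) (invRes b z * invRes b z) z := by
  rw [hasDerivAt_iff_tendsto_slope]
  have h1 : Tendsto (fun w => invRes b w * invRes b z) (𝓝[≠] z)
      (𝓝 (invRes b z * invRes b z)) :=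
    ((continuousAt_invRes hz).tendsto.mono_left nhdsWithin_le_nhds).mul_const _
  refine h1.congr' ?_
  filter_upwards [self_mem_nhdsWithin,
    mem_nhdsWithin_of_mem_nhds ((isOpen_invResSet b).mem_nhds hz)] with w hw hw'
  rw [slope_def_module, invRes_sub hw' hz, smul_smul, inv_mul_cancel₀ (sub_ne_zero.2 hw),
    one_smul]

/-- Neumann series: the resolvent set contains a disc of radius `‖(A - z)⁻¹‖⁻¹` around each of its
points, with the usual bound for the resolvent there. -/
theorem norm_invRes_le_of_near (hz : z ∈ invResSet b) {K : ℝ}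
    (hK : ‖invRes b z‖ ≤ K) (hw : ‖w - z‖ * K < 1) :
    w ∈ invResSet b ∧ ‖invRes b w‖ ≤ K / (1 - ‖w - z‖ * K) := by
  have hlt : ‖(w - z) • invRes b z‖ < 1 := by
    rw [norm_smul]
    exact lt_of_le_of_lt (by gcongr) hw
  have hmem : w ∈ invResSet b := by
    have hu : IsUnit (1 - (w - z) • invRes b z) := isUnit_one_sub_of_norm_lt_one hlt
    have : (1 : 𝔸) - w • b = (1 - (w - z) • invRes b z) * (1 - z • b) := by
      rw [sub_mul, one_mul, smul_mul_assoc, invRes_mul_cancel hz, sub_smul]; abel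
    rw [invResSet, mem_ofPred_eq, this]
    exact hu.mul hz
  refine ⟨hmem, ?_⟩
  have hpos : 0 < 1 - ‖w - z‖ * K := by linarith
  rw [le_div_iff₀ hpos]
  have h := invRes_sub hmem hz
  have h2 : ‖invRes b w‖ ≤ K + ‖w - z‖ * (‖invRes b w‖ * K) := by
    calc ‖invRes b w‖ = ‖invRes b z + (w - z) • (invRes b w * invRes b z)‖ := by
          rw [← h]; abel_nf
      _ ≤ ‖invRes b z‖ + ‖(w - z) • (invRes b w * invRes b z)‖ := norm_add_le _ _
      _ ≤ K + ‖w - z‖ * (‖invRes b w‖ * K) := by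
          rw [norm_smul]
          gcongr
          exact (norm_mul_le _ _).trans (by gcongr)
  linarith

end ResolventOfInverse

/-! ### Resolvent bounds outside a sector -/

section Sectorial

variable {X : Type*} [NormedAddCommGroup X] [InnerProductSpace ℂ X]

/-- The bounded operator `B` is the inverse of an operator whose numerical range lies in the sector
`|arg z| ≤ π / 2 - 2 α`. This is expressed by the rotations `e^{iφ}`, `|φ| ≤ 2 α`, which move the
sector inside the right half-plane; `inner ℂ (B y) y` is `⟨A u, u⟩` for `u = B y`, and
`cos φ * q.re - sin φ * q.im` is the real part of `e^{iφ} q`. -/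
def IsSectorialInverse (B : X →L[ℂ] X) (α : ℝ) : Prop :=
  ∀ φ : ℝ, |φ| ≤ 2 * α → ∀ y : X,
    0 ≤ Real.cos φ * (inner ℂ (B y) y).re - Real.sin φ * (inner ℂ (B y) y).im

theorem rotate_re_le_norm (φ : ℝ) (w : ℂ) : Real.cos φ * w.re - Real.sin φ * w.im ≤ ‖w‖ := by
  have h : (Complex.exp (φ * Complex.I) * w).re = Real.cos φ * w.re - Real.sin φ * w.im := by
    rw [Complex.mul_re, Complex.exp_ofReal_mul_I_re, Complex.exp_ofReal_mul_I_im]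
  rw [← h]
  refine (Complex.re_le_norm _).trans ?_
  rw [norm_mul, Complex.norm_exp_ofReal_mul_I, one_mul]

variable {B : X →L[ℂ] X} {α : ℝ}

theorem IsSectorialInverse.re_inner_nonneg (hB : IsSectorialInverse B α) (hα : 0 ≤ α) (y : X) :
    0 ≤ (inner ℂ (B y) y).re := by
  simpa using hB 0 (by simpa using hα) y

theorem apply_invRes_apply {z : ℂ} (hz : z ∈ invResSet B) (y : X) :
    invRes B z y = B (y + z • invRes B z y) := by
  have h := congrArg (fun T : X →L[ℂ] X => T y) (smul_mul_invRes hz)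
  simp only [smul_apply, mul_apply_eq_comp,
    sub_apply] at h
  rw [map_add, map_smul, h]
  abel

variable [CompleteSpace X]

/-- A half-plane `Re (e^{iφ} z) < 0` that misses the sector lies in the resolvent set. The operator
`1 - z B` is coercive up to the factor `-e^{iφ} z`, because
`-e^{iφ} z ⟨(1 - z B) x, x⟩ = -e^{iφ} z ‖x‖² + |z|² e^{iφ} ⟨B x, x⟩`. -/
theorem IsSectorialInverse.mem_invResSet (hB : IsSectorialInverse B α) {φ : ℝ} (hφ : |φ| ≤ 2 * α)
    {z : ℂ} (hz : Real.cos φ * z.re - Real.sin φ * z.im < 0) : z ∈ invResSet B := by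
  have hz0 : 0 < ‖z‖ := by
    rw [norm_pos_iff]; rintro rfl; simp at hz
  set c : ℝ := -(Real.cos φ * z.re - Real.sin φ * z.im) with hc
  have hcpos : 0 < c := by linarith
  refine ContinuousLinearMap.isUnit_of_forall_le_norm_inner_map (𝕜 := ℂ) (1 - z • B)
    (c := ⟨c / ‖z‖, by positivity⟩) (show (0 : ℝ) < c / ‖z‖ by positivity) fun x => ?_
  have e : inner ℂ ((1 - z • B) x) x
      = ((‖x‖ ^ 2 : ℝ) : ℂ) - (starRingEnd ℂ) z * inner ℂ (B x) x := by
    rw [sub_apply, inner_sub_left, smul_apply,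
      inner_smul_left, one_apply_eq_self, inner_self_eq_norm_sq_to_K]
    push_cast
    rfl
  rw [e]
  set q := inner ℂ (B x) x with hq
  have hq0 := hB φ hφ x
  rw [← hq] at hq0
  have key := rotate_re_le_norm φ (-z * (((‖x‖ ^ 2 : ℝ) : ℂ) - (starRingEnd ℂ) z * q))
  have e2 : -z * (((‖x‖ ^ 2 : ℝ) : ℂ) - (starRingEnd ℂ) z * q)
      = ((‖z‖ ^ 2 : ℝ) : ℂ) * q - ((‖x‖ ^ 2 : ℝ) : ℂ) * z := by
    have := Complex.mul_conj' z
    push_cast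
    linear_combination q * this
  rw [norm_mul, norm_neg, e2] at key
  simp only [Complex.sub_re, Complex.sub_im, Complex.re_ofReal_mul, Complex.im_ofReal_mul] at key
  have : ‖x‖ ^ 2 * (c / ‖z‖) = ‖x‖ ^ 2 * c / ‖z‖ := by ring
  change ‖x‖ ^ 2 * (c / ‖z‖) ≤ _
  rw [this, div_le_iff₀' hz0]
  have h3 : 0 ≤ ‖z‖ ^ 2 * (Real.cos φ * q.re - Real.sin φ * q.im) := by positivity
  rw [hc]
  linarith

theorem IsSectorialInverse.norm_invRes_le (hB : IsSectorialInverse B α) {φ : ℝ}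
    (hφ : |φ| ≤ 2 * α) {z : ℂ} {c : ℝ} (hc : 0 < c)
    (hz : Real.cos φ * z.re - Real.sin φ * z.im ≤ -c) : ‖invRes B z‖ ≤ 1 / c := by
  have hmem := hB.mem_invResSet hφ (z := z) (by linarith)
  refine ContinuousLinearMap.opNorm_le_bound _ (by positivity) fun y => ?_
  set u := invRes B z y with hu
  have h1 := hB φ hφ (y + z • u)
  rw [hu, ← apply_invRes_apply hmem y, ← hu, inner_add_right, inner_smul_right,
    inner_self_eq_norm_sq_to_K] at h1
  have h2 := rotate_re_le_norm φ (inner ℂ u y)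
  have h3 : ‖inner ℂ u y‖ ≤ ‖u‖ * ‖y‖ := norm_inner_le_norm u y
  have e : z * ((‖u‖ : ℂ)) ^ 2 = ((‖u‖ ^ 2 : ℝ) : ℂ) * z := by push_cast; ring
  change 0 ≤ Real.cos φ * (inner ℂ u y + z * ((‖u‖ : ℂ)) ^ 2).re
    - Real.sin φ * (inner ℂ u y + z * ((‖u‖ : ℂ)) ^ 2).im at h1
  rw [e] at h1
  simp only [Complex.add_re, Complex.add_im, Complex.re_ofReal_mul, Complex.im_ofReal_mul] at h1
  have h4 : c * ‖u‖ ^ 2 ≤ ‖u‖ * ‖y‖ := by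
    have : ‖u‖ ^ 2 * (Real.cos φ * z.re - Real.sin φ * z.im) ≤ ‖u‖ ^ 2 * (-c) := by gcongr
    linarith
  rw [one_div, inv_mul_eq_div, le_div_iff₀ hc]
  rcases (norm_nonneg u).eq_or_lt with h0 | h0
  · rw [← h0]; simp
  · have : ‖u‖ * (‖u‖ * c) ≤ ‖u‖ * ‖y‖ := by linarith
    exact le_of_mul_le_mul_left this h0

/-- The bound of the resolvent to the left of the two rays `Re z = tan α * |Im z|`. The rotation by
`± 2 α` is the one that puts the ray at the angle `α` behind the imaginary axis. -/
theorem IsSectorialInverse.resolvent_left_of_rays (hB : IsSectorialInverse B α) (hα₀ : 0 < α)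
    (hα₁ : α ≤ Real.pi / 4) {z : ℂ} (him : z.im ≠ 0) (hz : z.re ≤ Real.tan α * |z.im|) :
    z ∈ invResSet B ∧ ‖invRes B z‖ ≤ 1 / (Real.tan α * |z.im|) := by
  have hpi := Real.pi_pos
  have hcos : 0 < Real.cos α := Real.cos_pos_of_mem_Ioo ⟨by linarith, by linarith⟩
  have hcos2 : 0 ≤ Real.cos (2 * α) :=
    Real.cos_nonneg_of_mem_Icc ⟨by linarith, by linarith⟩
  have htan : 0 < Real.tan α := Real.tan_pos_of_pos_of_lt_pi_div_two hα₀ (by linarith)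
  have hid : Real.cos (2 * α) * Real.tan α - Real.sin (2 * α) = -Real.tan α := by
    rw [Real.cos_two_mul, Real.sin_two_mul, Real.tan_eq_sin_div_cos]
    field_simp
    ring
  have hpos : 0 < Real.tan α * |z.im| := by positivity
  have main : ∃ φ : ℝ, |φ| ≤ 2 * α ∧
      Real.cos φ * z.re - Real.sin φ * z.im ≤ -(Real.tan α * |z.im|) := by
    have h1 : Real.cos (2 * α) * z.re ≤ Real.cos (2 * α) * (Real.tan α * |z.im|) := by gcongr
    have h2 : Real.cos (2 * α) * (Real.tan α * |z.im|) - Real.sin (2 * α) * |z.im|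
        = -(Real.tan α * |z.im|) := by linear_combination |z.im| * hid
    rcases lt_or_gt_of_ne him with h | h
    · refine ⟨-(2 * α), by rw [abs_neg, abs_of_pos]; linarith, ?_⟩
      rw [Real.cos_neg, Real.sin_neg, ← h2]
      rw [abs_of_neg h] at h1 ⊢
      linarith
    · refine ⟨2 * α, by rw [abs_of_pos]; linarith, ?_⟩
      rw [← h2]
      rw [abs_of_pos h] at h1 ⊢
      linarith
  obtain ⟨φ, hφ, hle⟩ := main
  exact ⟨hB.mem_invResSet hφ (by linarith), hB.norm_invRes_le hφ hpos hle⟩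

/-- The closed region to the left of the contour that follows the line `Re z = μ` near the real
axis and the rays `Re z = τ * |Im z|` far from it. -/
def leftRegion (μ τ : ℝ) : Set ℂ := {z | z.re ≤ max μ (τ * |z.im|)}

theorem IsSectorialInverse.leftRegion_subset (hB : IsSectorialInverse B α) (hα₀ : 0 < α)
    (hα₁ : α ≤ Real.pi / 4) {μ : ℝ} (hμ₀ : 0 < μ) (hμ : ∀ z : ℂ, z.re ≤ μ → z ∈ invResSet B) :
    leftRegion μ (Real.tan α) ⊆ invResSet B := by
  intro z hz
  rcases le_max_iff.1 (show z.re ≤ max μ _ from hz) with h | h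
  · exact hμ z h
  · by_cases him : z.im = 0
    · exact hμ z (by rw [him] at h; simp at h; linarith)
    · exact (hB.resolvent_left_of_rays hα₀ hα₁ him h).1

/-- To the left of the contour the resolvent is `O (1 / (1 + |Im z|))`. -/
theorem IsSectorialInverse.exists_bound_leftRegion (hB : IsSectorialInverse B α) (hα₀ : 0 < α)
    (hα₁ : α ≤ Real.pi / 4) {μ : ℝ} (hμ₀ : 0 < μ) (hμ : ∀ z : ℂ, z.re ≤ μ → z ∈ invResSet B) :
    ∃ M : ℝ, 0 ≤ M ∧ ∀ z ∈ leftRegion μ (Real.tan α), ‖invRes B z‖ ≤ M / (1 + |z.im|) := by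
  have hpi := Real.pi_pos
  set τ := Real.tan α with hτ
  have htan : 0 < τ := Real.tan_pos_of_pos_of_lt_pi_div_two hα₀ (by linarith)
  have hcomp : IsCompact (Icc (-1) μ ×ℂ Icc (-(μ / τ)) (μ / τ)) :=
    isCompact_Icc.reProdIm isCompact_Icc
  obtain ⟨M₀, hM₀⟩ := hcomp.exists_bound_of_continuousOn (f := invRes B) (fun z hz =>
    (continuousAt_invRes (hμ z (Complex.mem_reProdIm.1 hz).1.2)).continuousWithinAt)
  set M₁ := max M₀ 1 with hM₁
  have hM₁0 : 1 ≤ M₁ := le_max_right _ _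
  refine ⟨1 / μ + 1 / τ + M₁ * (1 + μ / τ), by positivity, fun z hz => ?_⟩
  rw [le_div_iff₀ (by positivity)]
  by_cases h : μ ≤ τ * |z.im|
  · have him : 0 < |z.im| := by
      by_contra h'
      have : |z.im| = 0 := le_antisymm (not_lt.1 h') (abs_nonneg _)
      rw [this] at h; linarith
    have hre : z.re ≤ τ * |z.im| := (show z.re ≤ max μ _ from hz).trans (max_le h le_rfl)
    have hb := (hB.resolvent_left_of_rays hα₀ hα₁ (abs_pos.1 him) hre).2
    rw [← hτ] at hb
    calc ‖invRes B z‖ * (1 + |z.im|) ≤ 1 / (τ * |z.im|) * (1 + |z.im|) := by gcongr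
      _ = 1 / (τ * |z.im|) + 1 / τ := by field_simp
      _ ≤ 1 / μ + 1 / τ := by gcongr
      _ ≤ _ := by
        have : 0 ≤ M₁ * (1 + μ / τ) := by positivity
        linarith
  · push Not at h
    have hre : z.re ≤ μ := by
      rcases le_max_iff.1 (show z.re ≤ max μ _ from hz) with h' | h' <;> linarith
    have him : |z.im| ≤ μ / τ := by rw [le_div_iff₀ htan]; linarith
    have hb : ‖invRes B z‖ ≤ M₁ := by
      by_cases hneg : z.re ≤ -1
      · refine (hB.norm_invRes_le (φ := 0) (by simpa using hα₀.le) one_pos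
          (by simpa using hneg)).trans (by simpa using hM₁0)
      · push Not at hneg
        exact (hM₀ z (Complex.mem_reProdIm.2 ⟨⟨hneg.le, hre⟩, abs_le.1 him⟩)).trans
          (le_max_left _ _)
    calc ‖invRes B z‖ * (1 + |z.im|) ≤ M₁ * (1 + μ / τ) := by gcongr
      _ ≤ _ := by
        have : 0 < 1 / μ + 1 / τ := by positivity
        linarith

end Sectorial

/-! ### Integrals along the contour -/

section Contour

/-- The contour, parametrized by the imaginary part: the segment of `Re z = μ` inside the sector
`Re z ≥ τ * |Im z|`, continued by the two rays that bound this sector. -/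
noncomputable def contour (μ τ : ℝ) (y : ℝ) : ℂ := ((max μ (τ * |y|) : ℝ) : ℂ) + y * Complex.I

/-- The derivative of `contour`, with an arbitrary value at the two corners. -/
noncomputable def contourDeriv (μ τ : ℝ) (y : ℝ) : ℂ :=
  ((if μ < τ * y then τ else if μ < -(τ * y) then -τ else 0 : ℝ) : ℂ) + Complex.I

variable {μ τ : ℝ}

@[simp] theorem contour_re (y : ℝ) : (contour μ τ y).re = max μ (τ * |y|) := by simp [contour]

@[simp] theorem contour_im (y : ℝ) : (contour μ τ y).im = y := by simp [contour]

theorem continuous_contour : Continuous (contour μ τ) := by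
  unfold contour; fun_prop

theorem measurable_contourDeriv : Measurable (contourDeriv μ τ) := by
  unfold contourDeriv
  refine (Complex.measurable_ofReal.comp ?_).add_const _
  refine Measurable.ite ?_ measurable_const (Measurable.ite ?_ measurable_const measurable_const)
  · exact measurableSet_lt measurable_const (by fun_prop)
  · exact measurableSet_lt measurable_const (by fun_prop)

theorem norm_contourDeriv_le (hτ : 0 < τ) (y : ℝ) : ‖contourDeriv μ τ y‖ ≤ τ + 1 := by
  unfold contourDeriv
  refine (norm_add_le _ _).trans ?_
  rw [Complex.norm_I, Complex.norm_real]
  gcongr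
  split_ifs <;> simp [abs_of_pos hτ, hτ.le]

theorem norm_contourDeriv_of_segment {y : ℝ} (hτ : 0 < τ) (hy : |y| ≤ μ / τ) :
    ‖contourDeriv μ τ y‖ = 1 := by
  rw [le_div_iff₀ hτ] at hy
  have h1 : ¬ μ < τ * y := by nlinarith [le_abs_self y]
  have h2 : ¬ μ < -(τ * y) := by nlinarith [neg_abs_le y]
  simp [contourDeriv, h1, h2]

theorem norm_contourDeriv_le_sqrt (y : ℝ) :
    ‖contourDeriv μ τ y‖ ≤ Real.sqrt (1 + τ ^ 2) := by
  unfold contourDeriv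
  rw [Complex.norm_def, Complex.normSq_apply]
  refine Real.sqrt_le_sqrt ?_
  split_ifs <;> simp <;> nlinarith

theorem hasDerivAt_contour {y : ℝ} (hτ : 0 < τ) (hμ : 0 < μ) (hy : τ * |y| ≠ μ) :
    HasDerivAt (contour μ τ) (contourDeriv μ τ y) y := by
  have hI : HasDerivAt (fun y : ℝ => (y : ℂ) * Complex.I) Complex.I y := by
    simpa using (Complex.ofRealCLM.hasDerivAt (x := y)).mul_const Complex.I
  refine HasDerivAt.add ?_ hI
  refine HasDerivAt.ofReal_comp (f := fun y => max μ (τ * |y|)) ?_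
  rcases lt_or_gt_of_ne hy with h | h
  · have h1 : ¬ μ < τ * y := by nlinarith [le_abs_self y]
    have h2 : ¬ μ < -(τ * y) := by nlinarith [neg_abs_le y]
    rw [if_neg h1, if_neg h2]
    refine (hasDerivAt_const y μ).congr_of_eventuallyEq ?_
    filter_upwards [(by fun_prop : Continuous fun y : ℝ => τ * |y|).tendsto y |>.eventually_lt_const h]
      with x hx using max_eq_left hx.le
  · rcases le_total 0 y with h0 | h0
    · rw [abs_of_nonneg h0] at h
      rw [if_pos h]
      have hd : HasDerivAt (fun y : ℝ => τ * y) τ y := by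
        simpa using (hasDerivAt_id y).const_mul τ
      refine hd.congr_of_eventuallyEq ?_
      filter_upwards [(by fun_prop : Continuous fun y : ℝ => τ * y).tendsto y |>.eventually_const_lt h]
        with x hx
      have : 0 < x := by
        have := hμ.trans hx
        exact pos_of_mul_pos_right this hτ.le
      rw [abs_of_pos this, max_eq_right hx.le]
    · rw [abs_of_nonpos h0] at h
      have h' : μ < -(τ * y) := by linarith
      have h1 : ¬ μ < τ * y := by nlinarith
      rw [if_neg h1, if_pos h']
      have hd : HasDerivAt (fun y : ℝ => -(τ * y)) (-τ) y := by
        simpa using ((hasDerivAt_id y).const_mul τ).fun_neg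
      refine hd.congr_of_eventuallyEq ?_
      filter_upwards [(by fun_prop : Continuous fun y : ℝ => -(τ * y)).tendsto y
        |>.eventually_const_lt h'] with x hx
      have : x < 0 := by nlinarith
      rw [abs_of_neg this, mul_neg, max_eq_right hx.le]

variable {E : Type*} [NormedAddCommGroup E] [NormedSpace ℂ E]

/-- The integral of `f` along the contour, in the direction of increasing imaginary part. -/
noncomputable def contourIntegral (μ τ : ℝ) (f : ℂ → E) : E :=
  ∫ y : ℝ, contourDeriv μ τ y • f (contour μ τ y)

theorem integrable_contour (hτ : 0 < τ) {f : ℂ → E} (hf : Continuous fun y => f (contour μ τ y))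
    {K : ℝ} (hK : ∀ y, ‖f (contour μ τ y)‖ ≤ K * (1 + y ^ 2)⁻¹) :
    Integrable fun y : ℝ => contourDeriv μ τ y • f (contour μ τ y) := by
  refine Integrable.mono' ((integrable_inv_one_add_sq.const_mul K).const_mul (τ + 1))
    (measurable_contourDeriv.aestronglyMeasurable.smul hf.aestronglyMeasurable)
    (Eventually.of_forall fun y => ?_)
  rw [norm_smul]
  exact mul_le_mul (norm_contourDeriv_le hτ y) (hK y) (norm_nonneg _) (by positivity)

theorem tendsto_contourIntegral {ι : Type*} {l : Filter ι} [l.IsCountablyGenerated] (hτ : 0 < τ)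
    {f : ι → ℂ → E} {g : ℂ → E} {K : ℝ}
    (hf : ∀ᶠ i in l, Continuous fun y => f i (contour μ τ y))
    (hK : ∀ᶠ i in l, ∀ y, ‖f i (contour μ τ y)‖ ≤ K * (1 + y ^ 2)⁻¹)
    (hlim : ∀ y, Tendsto (fun i => f i (contour μ τ y)) l (𝓝 (g (contour μ τ y)))) :
    Tendsto (fun i => contourIntegral μ τ (f i)) l (𝓝 (contourIntegral μ τ g)) := by
  refine tendsto_integral_filter_of_dominated_convergence
    (fun y => (τ + 1) * (K * (1 + y ^ 2)⁻¹)) ?_ ?_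
    ((integrable_inv_one_add_sq.const_mul K).const_mul (τ + 1)) ?_
  · filter_upwards [hf] with i hi
    exact measurable_contourDeriv.aestronglyMeasurable.smul hi.aestronglyMeasurable
  · filter_upwards [hK] with i hi
    refine Eventually.of_forall fun y => ?_
    rw [norm_smul]
    exact mul_le_mul (norm_contourDeriv_le hτ y) (hi y) (norm_nonneg _) (by positivity)
  · exact Eventually.of_forall fun y => (hlim y).const_smul _

theorem hasDerivAt_contourIntegral (hτ : 0 < τ) {f f' : ℝ → ℂ → E} {x₀ : ℝ} {s : Set ℝ}
    (hs : s ∈ 𝓝 x₀) {K : ℝ} (hf : ∀ x ∈ s, Continuous fun y => f x (contour μ τ y))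
    (hK : ∀ y, ‖f x₀ (contour μ τ y)‖ ≤ K * (1 + y ^ 2)⁻¹)
    (hf' : Continuous fun y => f' x₀ (contour μ τ y))
    (hK' : ∀ x ∈ s, ∀ y, ‖f' x (contour μ τ y)‖ ≤ K * (1 + y ^ 2)⁻¹)
    (hderiv : ∀ x ∈ s, ∀ y, HasDerivAt (fun x => f x (contour μ τ y)) (f' x (contour μ τ y)) x) :
    HasDerivAt (fun x => contourIntegral μ τ (f x)) (contourIntegral μ τ (f' x₀)) x₀ := by
  refine (hasDerivAt_integral_of_dominated_loc_of_deriv_le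
    (F := fun x y => contourDeriv μ τ y • f x (contour μ τ y))
    (F' := fun x y => contourDeriv μ τ y • f' x (contour μ τ y))
    (bound := fun y => (τ + 1) * (K * (1 + y ^ 2)⁻¹)) hs ?_ (integrable_contour hτ
      (hf x₀ (mem_of_mem_nhds hs)) hK)
    (measurable_contourDeriv.aestronglyMeasurable.smul hf'.aestronglyMeasurable)
    (Eventually.of_forall fun y x hx => ?_)
    ((integrable_inv_one_add_sq.const_mul K).const_mul (τ + 1))
    (Eventually.of_forall fun y x hx => ?_)).2
  · filter_upwards [hs] with x hx
    exact measurable_contourDeriv.aestronglyMeasurable.smul (hf x hx).aestronglyMeasurable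
  · rw [norm_smul]
    exact mul_le_mul (norm_contourDeriv_le hτ y) (hK' x hx y) (norm_nonneg _) (by positivity)
  · exact (hderiv x hx y).const_smul (contourDeriv μ τ y)

/-- The integral of a derivative along the contour is the difference of the limits at its ends. -/
theorem contourIntegral_eq_of_hasDerivAt [CompleteSpace E] (hτ : 0 < τ) (hμ : 0 < μ)
    {Φ φ : ℂ → E} (hderiv : ∀ y, HasDerivAt Φ (φ (contour μ τ y)) (contour μ τ y))
    (hφ : Continuous fun y => φ (contour μ τ y))
    {K : ℝ} (hK : ∀ y, ‖φ (contour μ τ y)‖ ≤ K * (1 + y ^ 2)⁻¹) {a b : E}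
    (ha : Tendsto (fun y => Φ (contour μ τ y)) atTop (𝓝 a))
    (hb : Tendsto (fun y => Φ (contour μ τ y)) atBot (𝓝 b)) :
    contourIntegral μ τ φ = a - b := by
  have hint := integrable_contour hτ hφ hK
  have hlim := intervalIntegral_tendsto_integral hint tendsto_neg_atTop_atBot tendsto_id
  refine tendsto_nhds_unique hlim ?_
  refine (ha.sub (hb.comp tendsto_neg_atTop_atBot)).congr fun r => ?_
  refine (integral_eq_of_hasDerivAt_off_countable (s := {μ / τ, -(μ / τ)})
    (fun y => Φ (contour μ τ y)) _ (Set.toFinite _).countable ?_ (fun y hy => ?_)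
    hint.intervalIntegrable).symm
  · exact fun y _ => ((hderiv y).continuousAt.comp
      continuous_contour.continuousAt).continuousWithinAt
  · have hy' : τ * |y| ≠ μ := by
      intro h
      have h2 : |y| = μ / τ := by rw [eq_div_iff hτ.ne']; linarith
      rcases abs_eq (by positivity) |>.1 h2 with h3 | h3
      · exact hy.2 (by simp [h3])
      · exact hy.2 (by simp [h3])
    exact (hderiv y).scomp y (hasDerivAt_contour hτ hμ hy')

theorem inv_one_add_abs_sq_le (y : ℝ) : ((1 + |y|) ^ 2)⁻¹ ≤ (1 + y ^ 2)⁻¹ := by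
  gcongr
  nlinarith [abs_nonneg y, sq_abs y]

theorem norm_contour_le (hτ : 0 < τ) (hμ : 0 < μ) (y : ℝ) :
    ‖contour μ τ y‖ ≤ (μ + τ + 1) * (1 + |y|) := by
  refine (Complex.norm_le_abs_re_add_abs_im _).trans ?_
  rw [contour_re, contour_im, abs_of_pos (lt_max_of_lt_left hμ)]
  have h := abs_nonneg y
  have : max μ (τ * |y|) ≤ μ + τ * |y| :=
    max_le (by nlinarith) (by linarith)
  nlinarith

theorem norm_exp_contour (t y : ℝ) :
    ‖Complex.exp (-(t : ℂ) * contour μ τ y)‖ = Real.exp (-(t * max μ (τ * |y|))) := by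
  rw [Complex.norm_exp, ← Complex.ofReal_neg, Complex.re_ofReal_mul, contour_re, neg_mul]

theorem exists_bound_exp_contour (hτ : 0 < τ) (hμ : 0 < μ) {t₀ : ℝ} (ht₀ : 0 < t₀) :
    ∃ K : ℝ, 0 ≤ K ∧ ∀ t, t₀ ≤ t → ∀ y,
      ‖Complex.exp (-(t : ℂ) * contour μ τ y)‖ ≤ K * (1 + y ^ 2)⁻¹ ∧
      ‖contour μ τ y‖ * ‖Complex.exp (-(t : ℂ) * contour μ τ y)‖ ≤ K * (1 + y ^ 2)⁻¹ := by
  -- `exp (-x) ≤ 6 e / (1 + x) ^ 3` leaves a decay of order two after the multiplication by `z`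
  set m : ℝ := min 1 (t₀ * τ) with hm
  have hm0 : 0 < m := lt_min one_pos (by positivity)
  set c : ℝ := μ + τ + 1
  set C : ℝ := 6 * Real.exp 1 / m ^ 3 with hC
  have hC0 : 0 < C := by positivity
  have hexp : ∀ t, t₀ ≤ t → ∀ y, ‖Complex.exp (-(t : ℂ) * contour μ τ y)‖ ≤
      C * ((1 + |y|) ^ 3)⁻¹ := by
    intro t ht y
    rw [norm_exp_contour, Real.exp_neg, hC, ← div_eq_mul_inv, div_div, inv_eq_one_div,
      div_le_div_iff₀ (Real.exp_pos _) (by positivity)]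
    have h1 : m * (1 + |y|) ≤ 1 + t * max μ (τ * |y|) := by
      have h2 : t₀ * (τ * |y|) ≤ t * max μ (τ * |y|) :=
        mul_le_mul ht (le_max_right _ _) (by positivity) (by linarith)
      have h3 : m * |y| ≤ (t₀ * τ) * |y| := by gcongr; exact min_le_right _ _
      have h4 : m ≤ 1 := min_le_left _ _
      linarith
    have h5 := Real.pow_div_factorial_le_exp (1 + t * max μ (τ * |y|))
      (le_trans (show 0 ≤ m * (1 + |y|) by positivity) h1) 3
    have h6 : (m * (1 + |y|)) ^ 3 ≤ (1 + t * max μ (τ * |y|)) ^ 3 := by gcongr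
    rw [Real.exp_add] at h5
    norm_num [Nat.factorial] at h5
    rw [mul_pow] at h6
    linarith
  have hy3 : ∀ y : ℝ, ((1 + |y|) ^ 3)⁻¹ ≤ ((1 + |y|) ^ 2)⁻¹ := fun y => by
    have := abs_nonneg y
    gcongr
    · linarith
    · norm_num
  refine ⟨C + c * C, by positivity, fun t ht y => ⟨?_, ?_⟩⟩
  · calc _ ≤ C * ((1 + |y|) ^ 3)⁻¹ := hexp t ht y
      _ ≤ C * (1 + y ^ 2)⁻¹ := by
        exact mul_le_mul_of_nonneg_left ((hy3 y).trans (inv_one_add_abs_sq_le y)) hC0.le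
      _ ≤ _ := by gcongr; linarith [show 0 < c * C by positivity]
  · calc _ ≤ (c * (1 + |y|)) * (C * ((1 + |y|) ^ 3)⁻¹) :=
          mul_le_mul (norm_contour_le hτ hμ y) (hexp t ht y) (norm_nonneg _) (by positivity)
      _ = c * C * ((1 + |y|) ^ 2)⁻¹ := by field_simp
      _ ≤ c * C * (1 + y ^ 2)⁻¹ := 
        mul_le_mul_of_nonneg_left (inv_one_add_abs_sq_le y) (by positivity)
      _ ≤ _ := by gcongr; linarith

theorem contour_sub_mem_leftRegion {s : ℝ} (hs : 0 ≤ s) (y : ℝ) :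
    contour μ τ y - s ∈ leftRegion μ τ := by
  have h : (contour μ τ y - s).re ≤ max μ (τ * |(contour μ τ y - s).im|) := by
    rw [Complex.sub_re, Complex.sub_im, contour_re, contour_im, Complex.ofReal_re,
      Complex.ofReal_im, sub_zero]
    linarith
  exact h

theorem contour_mem_leftRegion (y : ℝ) : contour μ τ y ∈ leftRegion μ τ := by
  simpa using contour_sub_mem_leftRegion le_rfl y

end Contour

/-! ### Scalar contour integrals -/

section ScalarContour

variable {μ τ : ℝ}

theorem tendsto_cocompact_zero_of_bound {E : Type*} [NormedAddCommGroup E] {g : ℝ → E} {K : ℝ}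
    (h : ∀ y, ‖g y‖ ≤ K * (1 + y ^ 2)⁻¹) : Tendsto g (cocompact ℝ) (𝓝 0) := by
  refine squeeze_zero_norm h ?_
  have h1 : Tendsto (fun y : ℝ => 1 + ‖y‖ ^ 2) (cocompact ℝ) atTop :=
    tendsto_atTop_add_const_left _ _
      ((tendsto_pow_atTop two_ne_zero).comp tendsto_norm_cocompact_atTop)
  simpa [Function.comp_def] using (tendsto_inv_atTop_zero.comp h1).const_mul K

theorem contourIntegral_eq_zero_of_hasDerivAt {E : Type*} [NormedAddCommGroup E] [NormedSpace ℂ E]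
    [CompleteSpace E] (hτ : 0 < τ) (hμ : 0 < μ)
    {Φ φ : ℂ → E} (hderiv : ∀ y, HasDerivAt Φ (φ (contour μ τ y)) (contour μ τ y))
    (hφ : Continuous fun y => φ (contour μ τ y))
    {K K' : ℝ} (hK : ∀ y, ‖φ (contour μ τ y)‖ ≤ K * (1 + y ^ 2)⁻¹)
    (hK' : ∀ y, ‖Φ (contour μ τ y)‖ ≤ K' * (1 + y ^ 2)⁻¹) : contourIntegral μ τ φ = 0 := by
  have h := tendsto_cocompact_zero_of_bound hK'
  rw [contourIntegral_eq_of_hasDerivAt hτ hμ hderiv hφ hK (h.mono_left atTop_le_cocompact)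
    (h.mono_left atBot_le_cocompact), sub_zero]

theorem continuous_exp_contour (t : ℝ) :
    Continuous fun y => Complex.exp (-(t : ℂ) * contour μ τ y) :=
  Complex.continuous_exp.comp (continuous_const.mul continuous_contour)

theorem contourIntegral_exp (hτ : 0 < τ) (hμ : 0 < μ) {t : ℝ} (ht : 0 < t) :
    contourIntegral μ τ (fun z => Complex.exp (-(t : ℂ) * z)) = 0 := by
  obtain ⟨K, -, hK⟩ := exists_bound_exp_contour hτ hμ ht
  have ht' : (t : ℂ) ≠ 0 := by exact_mod_cast ht.ne'
  refine contourIntegral_eq_zero_of_hasDerivAt hτ hμ (K := K) (K' := K / t)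
    (Φ := fun z => -(Complex.exp (-(t : ℂ) * z) / t)) (fun y => ?_) (continuous_exp_contour t)
    (fun y => (hK t le_rfl y).1) (fun y => ?_)
  · have h := ((((hasDerivAt_id (contour μ τ y)).const_mul (-(t : ℂ))).cexp).div_const
      (t : ℂ)).fun_neg
    refine h.congr_deriv ?_
    simp only [id]
    field_simp
  · rw [norm_neg, norm_div, Complex.norm_real, Real.norm_of_nonneg ht.le, div_mul_eq_mul_div]
    gcongr
    exact (hK t le_rfl y).1

theorem one_le_norm_contour_add_one (hμ : 0 < μ) (y : ℝ) : 1 ≤ ‖contour μ τ y + 1‖ := by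
  refine le_trans ?_ (Complex.re_le_norm _)
  have : 0 < max μ (τ * |y|) := lt_max_of_lt_left hμ
  simp only [Complex.add_re, contour_re, Complex.one_re]
  linarith

theorem contour_add_one_ne_zero (hμ : 0 < μ) (y : ℝ) : contour μ τ y + 1 ≠ 0 :=
  norm_pos_iff.1 (one_pos.trans_le (one_le_norm_contour_add_one hμ y))

/-- The function `exp (-t z) / (z + 1)` has no pole to the right of the contour, so its integral
vanishes. Instead of closing the contour, one observes that `exp (-t)` times the integral does not
depend on `t > 0` and tends to `0` as `t → ∞`. -/
theorem contourIntegral_exp_div_add_one (hτ : 0 < τ) (hμ : 0 < μ) {t : ℝ} (ht : 0 < t) :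
    contourIntegral μ τ (fun z => Complex.exp (-(t : ℂ) * z) / (z + 1)) = 0 := by
  set h : ℝ → ℂ := fun t => contourIntegral μ τ (fun z => Complex.exp (-(t : ℂ) * (z + 1)) / (z + 1))
    with hh
  have hcont : Continuous fun y => contour μ τ y + 1 := continuous_contour.add continuous_const
  have hexp : ∀ (t : ℝ) (z : ℂ), Complex.exp (-(t : ℂ) * (z + 1))
      = Complex.exp (-(t : ℂ)) * Complex.exp (-(t : ℂ) * z) := fun t z => by
    rw [← Complex.exp_add]; congr 1; ring
  have hle : ∀ t : ℝ, 0 < t →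
      ‖Complex.exp (-(t : ℂ))‖ ≤ 1 := fun t ht => by
    rw [Complex.norm_exp]; simp [ht.le]
  have hfc : ∀ t : ℝ, Continuous fun y =>
      Complex.exp (-(t : ℂ) * (contour μ τ y + 1)) / (contour μ τ y + 1) := fun t =>
    (Complex.continuous_exp.comp (continuous_const.mul hcont)).div hcont
      (contour_add_one_ne_zero hμ)
  have hbd : ∀ t₀ : ℝ, 0 < t₀ → ∃ K : ℝ, ∀ t, t₀ ≤ t → ∀ y,
      ‖Complex.exp (-(t : ℂ) * (contour μ τ y + 1)) / (contour μ τ y + 1)‖ ≤ K * (1 + y ^ 2)⁻¹ ∧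
      ‖-Complex.exp (-(t : ℂ) * (contour μ τ y + 1))‖ ≤ K * (1 + y ^ 2)⁻¹ := by
    intro t₀ ht₀
    obtain ⟨K, -, hK⟩ := exists_bound_exp_contour hτ hμ ht₀
    refine ⟨K, fun t ht y => ?_⟩
    have h1 : ‖Complex.exp (-(t : ℂ) * (contour μ τ y + 1))‖ ≤ K * (1 + y ^ 2)⁻¹ := by
      rw [hexp, norm_mul]
      exact (mul_le_of_le_one_left (norm_nonneg _) (hle t (ht₀.trans_le ht))).trans (hK t ht y).1
    refine ⟨?_, by rwa [norm_neg]⟩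
    rw [norm_div]
    exact (div_le_self (norm_nonneg _) (one_le_norm_contour_add_one hμ y)).trans h1
  have hd : ∀ t ∈ Ioi (0 : ℝ), HasDerivAt h 0 t := by
    intro t ht
    obtain ⟨K, hK⟩ := hbd (t / 2) (half_pos ht)
    have hs : Ioi (t / 2) ∈ 𝓝 t := Ioi_mem_nhds (half_lt_self ht)
    have h1 := hasDerivAt_contourIntegral hτ (x₀ := t) hs (K := K)
      (f := fun t z => Complex.exp (-(t : ℂ) * (z + 1)) / (z + 1))
      (f' := fun t z => -Complex.exp (-(t : ℂ) * (z + 1))) (fun t _ => hfc t)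
      (fun y => (hK t (half_le_self (le_of_lt ht)) y).1)
      (Complex.continuous_exp.comp (continuous_const.mul hcont)).neg
      (fun t ht y => (hK t (le_of_lt ht) y).2) (fun t _ y => ?_)
    · have h2 : contourIntegral μ τ (fun z => -Complex.exp (-(t : ℂ) * (z + 1))) = 0 := by
        have : (fun y => contourDeriv μ τ y • (-Complex.exp (-(t : ℂ) * (contour μ τ y + 1))))
          = fun y => (-Complex.exp (-(t : ℂ))) •
            (contourDeriv μ τ y • Complex.exp (-(t : ℂ) * contour μ τ y)) := by
          funext y; rw [hexp]; simp only [smul_eq_mul]; ring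
        rw [contourIntegral, this, integral_smul]
        have h3 := contourIntegral_exp hτ hμ ht
        rw [contourIntegral] at h3
        rw [h3, smul_zero]
      exact h1.congr_deriv h2
    · have h4 : HasDerivAt (fun t : ℝ => -(t : ℂ) * (contour μ τ y + 1))
          (-1 * (contour μ τ y + 1)) t :=
        (Complex.ofRealCLM.hasDerivAt (x := t)).fun_neg.mul_const _
      refine (h4.cexp.div_const (contour μ τ y + 1)).congr_deriv ?_
      have := contour_add_one_ne_zero (τ := τ) hμ y
      field_simp
  have hconst : ∀ s ∈ Ioi (0 : ℝ), h s = h t := fun s hs =>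
    isOpen_Ioi.is_const_of_deriv_eq_zero isPreconnected_Ioi
      (fun u hu => (hd u hu).differentiableAt.differentiableWithinAt)
      (fun u hu => (hd u hu).deriv) hs ht
  have hlim : Tendsto h atTop (𝓝 (contourIntegral μ τ fun _ => (0 : ℂ))) := by
    obtain ⟨K, hK⟩ := hbd 1 one_pos
    refine tendsto_contourIntegral hτ (K := K) (Eventually.of_forall hfc)
      ((eventually_ge_atTop 1).mono fun t ht y => (hK t ht y).1) fun y => ?_
    rw [tendsto_zero_iff_norm_tendsto_zero]
    have hpos : 0 < max μ (τ * |y|) + 1 := by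
      have : 0 < max μ (τ * |y|) := lt_max_of_lt_left hμ
      linarith
    have h5 : Tendsto (fun t : ℝ => Real.exp (-(t * (max μ (τ * |y|) + 1)))) atTop (𝓝 0) :=
      Real.tendsto_exp_neg_atTop_nhds_zero.comp (tendsto_id.atTop_mul_const hpos)
    have h6 := h5.div_const ‖contour μ τ y + 1‖
    rw [zero_div] at h6
    refine h6.congr fun t => ?_
    rw [norm_div, Complex.norm_exp, ← Complex.ofReal_neg, Complex.re_ofReal_mul, Complex.add_re,
      contour_re, Complex.one_re, neg_mul]
  have hzero : h t = 0 := by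
    have h7 : Tendsto h atTop (𝓝 (h t)) :=
      tendsto_const_nhds.congr' ((eventually_gt_atTop 0).mono fun s hs => (hconst s hs).symm)
    have h8 := tendsto_nhds_unique h7 hlim
    simpa [contourIntegral] using h8
  have h9 : h t = Complex.exp (-(t : ℂ)) *
      contourIntegral μ τ (fun z => Complex.exp (-(t : ℂ) * z) / (z + 1)) := by
    rw [hh]
    simp only [contourIntegral]
    rw [← integral_const_mul]
    congr 1
    funext y
    rw [hexp]
    simp only [smul_eq_mul]
    ring
  rw [hzero] at h9
  exact (mul_eq_zero.1 h9.symm).resolve_left (Complex.exp_ne_zero _)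

/-- The distance to a point at distance `1` to the right of the contour. -/
theorem exists_bound_sub_leftRegion (hτ : 0 < τ) (hμ : 0 < μ) :
    ∃ k : ℝ, 0 < k ∧ ∀ z ∈ leftRegion μ τ, k * (1 + |z.im|) ≤ ‖((μ + 1 : ℝ) : ℂ) - z‖ := by
  refine ⟨min (1 / 2) (1 / (1 + τ / μ)), by positivity, fun z hz => ?_⟩
  have him : |z.im| ≤ ‖((μ + 1 : ℝ) : ℂ) - z‖ := by
    have := Complex.abs_im_le_norm (((μ + 1 : ℝ) : ℂ) - z)
    rwa [Complex.sub_im, Complex.ofReal_im, zero_sub, abs_neg] at this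
  have h0 := abs_nonneg z.im
  by_cases h : z.re ≤ μ
  · have hre : 1 ≤ ‖((μ + 1 : ℝ) : ℂ) - z‖ := by
      refine le_trans ?_ (Complex.re_le_norm _)
      rw [Complex.sub_re, Complex.ofReal_re]
      linarith
    calc _ ≤ 1 / 2 * (1 + |z.im|) := by gcongr; exact min_le_left _ _
      _ ≤ _ := by linarith
  · have h1 : μ < τ * |z.im| := by
      rcases le_max_iff.1 (show z.re ≤ max μ (τ * |z.im|) from hz) with h' | h' <;> linarith
    have h2 : 1 ≤ τ / μ * |z.im| := by
      rw [div_mul_eq_mul_div, le_div_iff₀ hμ]; linarith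
    calc _ ≤ 1 / (1 + τ / μ) * (1 + |z.im|) := by gcongr; exact min_le_right _ _
      _ ≤ |z.im| := by
        rw [one_div, inv_mul_le_iff₀ (by positivity)]
        linarith
      _ ≤ _ := him

theorem exists_bound_add_one_inv (hτ : 0 < τ) (hμ : 0 < μ) :
    ∃ K : ℝ, ∀ y, ‖(contour μ τ y + 1)⁻¹ + (((μ + 1 : ℝ) : ℂ) - contour μ τ y)⁻¹‖
      ≤ K * (1 + y ^ 2)⁻¹ := by
  obtain ⟨k, hk, hkle⟩ := exists_bound_sub_leftRegion hτ hμ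
  set c : ℝ := μ + 1 with hc
  have hc1 : 0 < 1 + c := by linarith
  refine ⟨(1 + c) * (2 / k), fun y => ?_⟩
  have hk' : k * (1 + |y|) ≤ ‖(c : ℂ) - contour μ τ y‖ := by
    simpa using hkle _ (contour_mem_leftRegion y)
  have hsub : (c : ℂ) - contour μ τ y ≠ 0 :=
    norm_pos_iff.1 (lt_of_lt_of_le (by positivity) hk')
  have hsum : (contour μ τ y + 1)⁻¹ + ((c : ℂ) - contour μ τ y)⁻¹
      = (1 + c) / ((contour μ τ y + 1) * (c - contour μ τ y)) := by
    field_simp [hsub, contour_add_one_ne_zero (τ := τ) hμ y]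
    ring
  have h2 : 1 + |y| ≤ 2 * ‖contour μ τ y + 1‖ := by
    have h3 := one_le_norm_contour_add_one (τ := τ) hμ y
    have h4 := Complex.abs_im_le_norm (contour μ τ y + 1)
    rw [Complex.add_im, contour_im, Complex.one_im, add_zero] at h4
    linarith
  rw [hsum, norm_div, norm_mul]
  have h5 : ‖(1 + c : ℂ)‖ = 1 + c := by
    rw [← Complex.ofReal_one, ← Complex.ofReal_add, Complex.norm_real, Real.norm_of_nonneg hc1.le]
  rw [h5, mul_assoc, div_eq_mul_inv]
  refine mul_le_mul_of_nonneg_left ?_ hc1.le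
  calc (‖contour μ τ y + 1‖ * ‖(c : ℂ) - contour μ τ y‖)⁻¹
      ≤ ((1 + |y|) / 2 * (k * (1 + |y|)))⁻¹ := by
        gcongr
        linarith
    _ = 2 / k * ((1 + |y|) ^ 2)⁻¹ := by field_simp
    _ ≤ 2 / k * (1 + y ^ 2)⁻¹ :=
      mul_le_mul_of_nonneg_left (inv_one_add_abs_sq_le y) (by positivity)

/-- The sign of the imaginary part is preserved for real `c > -1`; this keeps the quotient in the
slit plane along the contour. -/
theorem im_add_one_div_sub (c : ℝ) (z : ℂ) :
    ((z + 1) / (c - z)).im = (1 + c) * z.im / Complex.normSq (c - z) := by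
  rw [Complex.div_im]
  simp only [Complex.add_re, Complex.add_im, Complex.sub_re, Complex.sub_im, Complex.one_re,
    Complex.one_im, Complex.ofReal_re, Complex.ofReal_im]
  ring

/-- The residue computation `∫ (1 / (z + 1) + 1 / (c - z)) dz = 2πi` for a point `c` to the right
of the contour. The quotient `(z + 1) / (c - z)` stays in the slit plane, and its logarithm, a
primitive, tends to `± πi` at the two ends. -/
theorem contourIntegral_add_one_inv (hτ : 0 < τ) (hμ : 0 < μ) :
    contourIntegral μ τ (fun z => (z + 1)⁻¹ + (((μ + 1 : ℝ) : ℂ) - z)⁻¹)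
      = 2 * Real.pi * Complex.I := by
  obtain ⟨k, hk, hkle⟩ := exists_bound_sub_leftRegion hτ hμ
  set c : ℝ := μ + 1 with hc
  have hc1 : 0 < 1 + c := by linarith
  obtain ⟨K, hK⟩ := exists_bound_add_one_inv hτ hμ
  have hk' : ∀ y, k * (1 + |y|) ≤ ‖(c : ℂ) - contour μ τ y‖ := fun y => by
    simpa using hkle _ (contour_mem_leftRegion y)
  have hsub : ∀ y, (c : ℂ) - contour μ τ y ≠ 0 := fun y =>
    norm_pos_iff.1 (lt_of_lt_of_le (by positivity) (hk' y))
  have hadd := contour_add_one_ne_zero (τ := τ) hμ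
  have hsum : ∀ y, (contour μ τ y + 1)⁻¹ + ((c : ℂ) - contour μ τ y)⁻¹
      = (1 + c) / ((contour μ τ y + 1) * (c - contour μ τ y)) := fun y => by
    field_simp [hsub y, hadd y]
    ring
  have hslit : ∀ y, (contour μ τ y + 1) / (c - contour μ τ y) ∈ Complex.slitPlane := by
    intro y
    by_cases hy : y = 0
    · left
      have e : contour μ τ y = (μ : ℂ) := by simp [contour, hy, hμ.le]
      have e2 : ((μ : ℂ) + 1) / (c - μ) = ((μ + 1 : ℝ) : ℂ) := by rw [hc]; push_cast; simp
      rw [e, e2, Complex.ofReal_re]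
      linarith
    · right
      rw [im_add_one_div_sub, contour_im]
      have := Complex.normSq_pos.2 (hsub y)
      positivity
  have hlim : Tendsto (fun y => (contour μ τ y + 1) / (c - contour μ τ y)) (cocompact ℝ)
      (𝓝 (-1)) := by
    have h1 : Tendsto (fun y => ‖(c : ℂ) - contour μ τ y‖) (cocompact ℝ) atTop := by
      refine tendsto_atTop_mono hk' (Tendsto.const_mul_atTop hk ?_)
      exact tendsto_atTop_add_const_left _ _ tendsto_norm_cocompact_atTop
    have h2 : Tendsto (fun y => ((c : ℂ) - contour μ τ y)⁻¹) (cocompact ℝ) (𝓝 0) := by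
      rw [tendsto_zero_iff_norm_tendsto_zero]
      simpa using! tendsto_inv_atTop_zero.comp h1
    have h3 := (h2.const_mul (1 + c : ℂ)).const_add (-1)
    rw [mul_zero, add_zero] at h3
    refine h3.congr fun y => ?_
    field_simp [hsub y]
    ring
  have hnorm : Real.log ‖(-1 : ℂ)‖ = 0 := by simp
  have htop : Tendsto (fun y => Complex.log ((contour μ τ y + 1) / (c - contour μ τ y))) atTop
      (𝓝 (Real.pi * Complex.I)) := by
    have h := Complex.tendsto_log_nhdsWithin_im_nonneg_of_re_neg_of_im_zero (z := -1)
      (by simp) (by simp)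
    rw [hnorm, Complex.ofReal_zero, zero_add] at h
    refine h.comp (tendsto_nhdsWithin_iff.2 ⟨hlim.mono_left atTop_le_cocompact, ?_⟩)
    filter_upwards [eventually_gt_atTop 0] with y hy
    rw [im_add_one_div_sub, contour_im]
    have := Complex.normSq_pos.2 (hsub y)
    positivity
  have hbot : Tendsto (fun y => Complex.log ((contour μ τ y + 1) / (c - contour μ τ y))) atBot
      (𝓝 (-(Real.pi * Complex.I))) := by
    have h := Complex.tendsto_log_nhdsWithin_im_neg_of_re_neg_of_im_zero (z := -1)
      (by simp) (by simp)
    rw [hnorm, Complex.ofReal_zero, zero_sub] at h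
    refine h.comp (tendsto_nhdsWithin_iff.2 ⟨hlim.mono_left atBot_le_cocompact, ?_⟩)
    filter_upwards [eventually_lt_atBot 0] with y hy
    rw [im_add_one_div_sub, contour_im]
    have := Complex.normSq_pos.2 (hsub y)
    exact div_neg_of_neg_of_pos (mul_neg_of_pos_of_neg hc1 hy) this
  refine (contourIntegral_eq_of_hasDerivAt hτ hμ (K := K)
    (Φ := fun z => Complex.log ((z + 1) / (c - z))) (fun y => ?_) ?_ (fun y => ?_) htop hbot).trans
    (by ring)
  · have h1 : HasDerivAt (fun z : ℂ => (z + 1) / (c - z))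
        ((1 * (c - contour μ τ y) - (contour μ τ y + 1) * (-1)) / (c - contour μ τ y) ^ 2)
        (contour μ τ y) :=
      ((hasDerivAt_id _).add_const 1).fun_div ((hasDerivAt_id _).const_sub (c : ℂ)) (hsub y)
    refine (h1.clog (hslit y)).congr_deriv ?_
    rw [hsum]
    have := hsub y
    have := hadd y
    field_simp
    ring
  · exact ((continuous_contour.add continuous_const).inv₀ hadd).add
      ((continuous_const.sub continuous_contour).inv₀ hsub)
  · exact hK y

end ScalarContour

/-! ### Translation of the contour -/

section OperatorContour

variable {𝔸 : Type*} [NormedRing 𝔸] [NormedAlgebra ℂ 𝔸] [CompleteSpace 𝔸]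
variable {b : 𝔸} {μ τ M : ℝ}

theorem continuous_invRes_contour (hreg : leftRegion μ τ ⊆ invResSet b) {s : ℝ} (hs : 0 ≤ s) :
    Continuous fun y => invRes b (contour μ τ y - s) :=
  continuous_iff_continuousAt.2 fun y =>
    ContinuousAt.comp (f := fun y => contour μ τ y - (s : ℂ))
      (continuousAt_invRes (hreg (contour_sub_mem_leftRegion hs y)))
      (continuous_contour.sub continuous_const).continuousAt

/-- The resolvent has no singularity to the left of the contour. The integral is therefore not
changed by a translation of the contour to the left, and it tends to `0` when this translation
tends to infinity. -/
theorem contourIntegral_invRes_div (hτ : 0 < τ) (hμ : 0 < μ)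
    (hreg : leftRegion μ τ ⊆ invResSet b) (hM₀ : 0 ≤ M)
    (hM : ∀ z ∈ leftRegion μ τ, ‖invRes b z‖ ≤ M / (1 + |z.im|)) :
    contourIntegral μ τ (fun z => (((μ + 1 : ℝ) : ℂ) - z)⁻¹ • invRes b z) = 0 := by
  obtain ⟨k, hk, hkle⟩ := exists_bound_sub_leftRegion hτ hμ
  set c : ℝ := μ + 1 with hc
  have hsub : ∀ z ∈ leftRegion μ τ, (c : ℂ) - z ≠ 0 := fun z hz =>
    norm_pos_iff.1 (lt_of_lt_of_le (by positivity) (hkle z hz))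
  set f : ℂ → 𝔸 := fun z => ((c : ℂ) - z)⁻¹ • invRes b z with hf
  set f' : ℂ → 𝔸 := fun z => ((c : ℂ) - z)⁻¹ • (invRes b z * invRes b z)
    + (1 / ((c : ℂ) - z) ^ 2) • invRes b z with hf'
  set K : ℝ := M / k + (M ^ 2 / k + M / k ^ 2) with hKdef
  have hinv : ∀ z ∈ leftRegion μ τ, ‖((c : ℂ) - z)⁻¹‖ ≤ 1 / k * (1 + |z.im|)⁻¹ := fun z hz => by
    rw [norm_inv, one_div, ← mul_inv]
    have := hkle z hz
    gcongr
  have hfb : ∀ z ∈ leftRegion μ τ, ‖f z‖ ≤ K * (1 + z.im ^ 2)⁻¹ := fun z hz => by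
    have h0 := abs_nonneg z.im
    calc ‖f z‖ ≤ 1 / k * (1 + |z.im|)⁻¹ * (M / (1 + |z.im|)) := by
          rw [hf, norm_smul]
          exact mul_le_mul (hinv z hz) (hM z hz) (norm_nonneg _) (by positivity)
      _ = M / k * ((1 + |z.im|) ^ 2)⁻¹ := by field_simp
      _ ≤ K * (1 + z.im ^ 2)⁻¹ := mul_le_mul
        (by rw [hKdef]; linarith [show 0 ≤ M ^ 2 / k + M / k ^ 2 by positivity])
        (inv_one_add_abs_sq_le _) (by positivity) (by positivity)
  have hfb' : ∀ z ∈ leftRegion μ τ, ‖f' z‖ ≤ K * (1 + z.im ^ 2)⁻¹ := fun z hz => by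
    have h0 := abs_nonneg z.im
    have h1 : (1 + |z.im|)⁻¹ ≤ 1 := inv_le_one_of_one_le₀ (by linarith)
    calc ‖f' z‖ ≤ ‖((c : ℂ) - z)⁻¹ • (invRes b z * invRes b z)‖
          + ‖(1 / ((c : ℂ) - z) ^ 2) • invRes b z‖ := norm_add_le _ _
      _ ≤ 1 / k * (1 + |z.im|)⁻¹ * (M / (1 + |z.im|) * (M / (1 + |z.im|)))
          + (1 / k * (1 + |z.im|)⁻¹) ^ 2 * (M / (1 + |z.im|)) := by
          rw [norm_smul, norm_smul, one_div, ← inv_pow, norm_pow]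
          gcongr
          · exact hinv z hz
          · exact (norm_mul_le _ _).trans
              (mul_le_mul (hM z hz) (hM z hz) (norm_nonneg _) (by positivity))
          · exact hinv z hz
          · exact hM z hz
      _ = (M ^ 2 / k + M / k ^ 2) * ((1 + |z.im|) ^ 2)⁻¹ * (1 + |z.im|)⁻¹ := by field_simp
      _ ≤ (M ^ 2 / k + M / k ^ 2) * ((1 + |z.im|) ^ 2)⁻¹ :=
          mul_le_of_le_one_right (by positivity) h1
      _ ≤ K * (1 + z.im ^ 2)⁻¹ := mul_le_mul
        (by rw [hKdef]; linarith [show 0 ≤ M / k by positivity])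
        (inv_one_add_abs_sq_le _) (by positivity) (by positivity)
  have hfd : ∀ z ∈ leftRegion μ τ, HasDerivAt f (f' z) z := fun z hz => by
    have h1 : HasDerivAt (fun z : ℂ => ((c : ℂ) - z)⁻¹) (1 / ((c : ℂ) - z) ^ 2) z := by
      simpa using ((hasDerivAt_id z).const_sub (c : ℂ)).fun_inv (hsub z hz)
    exact h1.smul (hasDerivAt_invRes (hreg hz))
  have hmem : ∀ {s : ℝ}, 0 ≤ s → ∀ y, contour μ τ y - s ∈ leftRegion μ τ :=
    fun hs y => contour_sub_mem_leftRegion hs y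
  have him : ∀ s y : ℝ, (contour μ τ y - s).im = y := fun s y => by simp
  have hfb₁ : ∀ {s : ℝ}, 0 ≤ s → ∀ y, ‖f (contour μ τ y - s)‖ ≤ K * (1 + y ^ 2)⁻¹ :=
    fun {s} hs y => by simpa only [him] using hfb _ (hmem hs y)
  have hfb₂ : ∀ {s : ℝ}, 0 ≤ s → ∀ y, ‖-f' (contour μ τ y - s)‖ ≤ K * (1 + y ^ 2)⁻¹ :=
    fun {s} hs y => by simpa only [him, norm_neg] using hfb' _ (hmem hs y)
  have hsubc : ∀ {s : ℝ}, 0 ≤ s → Continuous fun y => ((c : ℂ) - (contour μ τ y - s))⁻¹ :=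
    fun {s} hs => (continuous_const.sub (continuous_contour.sub continuous_const)).inv₀
      fun y => hsub _ (hmem hs y)
  have hfc : ∀ {s : ℝ}, 0 ≤ s → Continuous fun y => f (contour μ τ y - s) := fun {s} hs =>
    (hsubc hs).smul (continuous_invRes_contour hreg hs)
  have hfc' : ∀ {s : ℝ}, 0 ≤ s → Continuous fun y => -f' (contour μ τ y - s) := fun {s} hs => by
    have h1 := continuous_invRes_contour hreg hs
    have h2 := hsubc hs
    have h3 : Continuous fun y => 1 / ((c : ℂ) - (contour μ τ y - s)) ^ 2 := by
      simpa only [one_div, inv_pow] using h2.fun_pow 2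
    exact ((h2.smul (h1.mul h1)).add (h3.smul h1)).neg
  set H : ℝ → 𝔸 := fun s => contourIntegral μ τ (fun z => f (z - s)) with hH
  have hd : ∀ s ∈ Ioi (0 : ℝ), HasDerivAt H 0 s := by
    intro s hs
    have h1 := hasDerivAt_contourIntegral hτ (x₀ := s) (Ioi_mem_nhds hs) (K := K)
      (f := fun s z => f (z - s)) (f' := fun s z => -f' (z - s))
      (fun s hs => hfc (le_of_lt hs)) (hfb₁ (le_of_lt hs)) (hfc' (le_of_lt hs))
      (fun s hs => hfb₂ (le_of_lt hs)) (fun s hs y => ?_)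
    · refine h1.congr_deriv (contourIntegral_eq_zero_of_hasDerivAt hτ hμ
        (Φ := fun z => -f (z - s)) (fun y => ?_) (hfc' (le_of_lt hs)) (hfb₂ (le_of_lt hs))
        (K' := K) fun y => by rw [norm_neg]; exact hfb₁ (le_of_lt hs) y)
      exact ((hfd _ (hmem (le_of_lt hs) y)).comp_sub_const _ _).fun_neg
    · have h2 : HasDerivAt (fun s : ℝ => contour μ τ y - (s : ℂ)) (-1) s :=
        (Complex.ofRealCLM.hasDerivAt (x := s)).const_sub _
      simpa using! (hfd _ (hmem (le_of_lt hs) y)).scomp s h2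
  have hconst : ∀ s ∈ Ioi (0 : ℝ), H s = H 1 := fun s hs =>
    isOpen_Ioi.is_const_of_deriv_eq_zero isPreconnected_Ioi
      (fun u hu => (hd u hu).differentiableAt.differentiableWithinAt)
      (fun u hu => (hd u hu).deriv) hs (by simp)
  have hlim : Tendsto H atTop (𝓝 (contourIntegral μ τ fun _ => (0 : 𝔸))) := by
    refine tendsto_contourIntegral hτ (K := K)
      ((eventually_ge_atTop 0).mono fun s hs => hfc hs)
      ((eventually_ge_atTop 0).mono fun s hs => hfb₁ hs) fun y => ?_
    have h3 : Tendsto (fun s : ℝ => ‖(c : ℂ) - (contour μ τ y - s)‖) atTop atTop := by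
      refine tendsto_atTop_mono (fun s => (?_ : s + (c - (contour μ τ y).re) ≤ _).trans
        (Complex.re_le_norm _)) (tendsto_atTop_add_const_right _ _ tendsto_id)
      simp only [Complex.sub_re, Complex.ofReal_re]
      linarith
    refine squeeze_zero_norm' (a := fun s : ℝ => ‖(c : ℂ) - (contour μ τ y - s)‖⁻¹ * M) ?_
      (by simpa using (tendsto_inv_atTop_zero.comp h3).mul_const M)
    filter_upwards [eventually_ge_atTop 0] with s hs
    rw [hf, norm_smul, norm_inv]
    refine mul_le_mul_of_nonneg_left ((hM _ (hmem hs y)).trans ?_) (by positivity)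
    exact div_le_self hM₀ (by linarith [abs_nonneg (contour μ τ y - (s : ℂ)).im])
  have hlim0 : Tendsto H (𝓝[>] 0) (𝓝 (contourIntegral μ τ f)) := by
    refine tendsto_contourIntegral hτ (K := K)
      (eventually_nhdsWithin_of_forall fun s hs => hfc (le_of_lt hs))
      (eventually_nhdsWithin_of_forall fun s hs => hfb₁ (le_of_lt hs)) fun y => ?_
    have h4 : Tendsto (fun s : ℝ => contour μ τ y - (s : ℂ)) (𝓝 0) (𝓝 (contour μ τ y)) := by
      have : Continuous fun s : ℝ => contour μ τ y - (s : ℂ) := by fun_prop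
      simpa using this.tendsto 0
    exact ((hfd _ (contour_mem_leftRegion y)).continuousAt.tendsto.comp h4).mono_left
      nhdsWithin_le_nhds
  have h5 : H 1 = 0 := by
    have h6 : Tendsto H atTop (𝓝 (H 1)) :=
      tendsto_const_nhds.congr' ((eventually_gt_atTop 0).mono fun s hs => (hconst s hs).symm)
    simpa [contourIntegral] using tendsto_nhds_unique h6 hlim
  have h7 : Tendsto H (𝓝[>] 0) (𝓝 (H 1)) :=
    tendsto_const_nhds.congr' (eventually_nhdsWithin_of_forall fun s hs => (hconst s hs).symm)
  rw [tendsto_nhds_unique hlim0 h7, h5]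

end OperatorContour

/-! ### The contour integral for the semigroup -/

section SemigroupIntegral

variable {𝔸 : Type*} [NormedRing 𝔸] [NormedAlgebra ℂ 𝔸]

/-- The contour with parameters `μ`, `τ` lies in the resolvent set of the inverse of `b`, as does
everything to the left of it, and the resolvent is bounded by `M / (1 + |Im z|)` there. -/
structure IsAdmissibleContour (b : 𝔸) (μ τ M : ℝ) : Prop where
  mu_pos : 0 < μ
  tau_pos : 0 < τ
  bound_nonneg : 0 ≤ M
  subset : leftRegion μ τ ⊆ invResSet b
  norm_le : ∀ z ∈ leftRegion μ τ, ‖invRes b z‖ ≤ M / (1 + |z.im|)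

/-- The operator `e^{-tA}` for `t > 0` as a contour integral of the resolvent of `A = b⁻¹`. -/
noncomputable def semigroupIntegral (b : 𝔸) (μ τ t : ℝ) : 𝔸 :=
  (2 * Real.pi * Complex.I : ℂ)⁻¹ •
    contourIntegral μ τ (fun z => Complex.exp (-(t : ℂ) * z) • invRes b z)

/-- The operator `A e^{-tA}` for `t > 0` as a contour integral of the resolvent of `A = b⁻¹`. -/
noncomputable def generatorIntegral (b : 𝔸) (μ τ t : ℝ) : 𝔸 :=
  (2 * Real.pi * Complex.I : ℂ)⁻¹ •
    contourIntegral μ τ (fun z => (z * Complex.exp (-(t : ℂ) * z)) • invRes b z)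

variable {b : 𝔸} {μ τ M : ℝ}

theorem IsAdmissibleContour.norm_invRes_contour_le (h : IsAdmissibleContour b μ τ M) (y : ℝ) :
    ‖invRes b (contour μ τ y)‖ ≤ M :=
  (h.norm_le _ (contour_mem_leftRegion y)).trans
    (div_le_self h.bound_nonneg (by linarith [abs_nonneg (contour μ τ y).im]))

/-- The resolvent identity `(A - z)⁻¹ A⁻¹ = (c - z)⁻¹ (A⁻¹ - (A - z)⁻¹ (1 - c A⁻¹))`. -/
theorem invRes_mul_eq {c z : ℂ} (hz : z ∈ invResSet b) (hc : c - z ≠ 0) :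
    invRes b z * b = (c - z)⁻¹ • b - ((c - z)⁻¹ • invRes b z) * (1 - c • b) := by
  have h1 := invRes_mul_cancel hz
  rw [mul_sub, mul_one, mul_smul_comm] at h1
  rw [smul_mul_assoc, ← smul_sub, eq_inv_smul_iff₀ hc, mul_sub, mul_one, mul_smul_comm]
  nth_rewrite 3 [← h1]
  module

theorem IsAdmissibleContour.exists_bound (h : IsAdmissibleContour b μ τ M) {t₀ : ℝ}
    (ht₀ : 0 < t₀) : ∃ K : ℝ, ∀ t, t₀ ≤ t → ∀ y,
      ‖Complex.exp (-(t : ℂ) * contour μ τ y) • invRes b (contour μ τ y)‖ ≤ K * (1 + y ^ 2)⁻¹ ∧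
      ‖(contour μ τ y * Complex.exp (-(t : ℂ) * contour μ τ y)) • invRes b (contour μ τ y)‖
        ≤ K * (1 + y ^ 2)⁻¹ := by
  obtain ⟨K, hK0, hK⟩ := exists_bound_exp_contour h.tau_pos h.mu_pos ht₀
  have hM := h.bound_nonneg
  refine ⟨K * M, fun t ht y => ⟨?_, ?_⟩⟩
  · rw [norm_smul, mul_right_comm]
    exact mul_le_mul (hK t ht y).1 (h.norm_invRes_contour_le y) (norm_nonneg _) (by positivity)
  · rw [norm_smul, norm_mul, mul_right_comm K]
    exact mul_le_mul (hK t ht y).2 (h.norm_invRes_contour_le y) (norm_nonneg _) (by positivity)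

/-- The estimate of the contour integral: the segment of `Re z = μ` has the length `2 μ / τ`, and on
the rays `1 / |Im z| ≤ τ / μ`. -/
theorem IsAdmissibleContour.norm_semigroupIntegral_le (h : IsAdmissibleContour b μ τ M) {N : ℝ}
    (hN : ∀ y, |y| ≤ μ / τ → ‖invRes b (contour μ τ y)‖ ≤ N)
    (hrays : ∀ y, μ ≤ τ * |y| → ‖invRes b (contour μ τ y)‖ ≤ 1 / (τ * |y|)) {t : ℝ} (ht : 0 < t) :
    ‖semigroupIntegral b μ τ t‖
      ≤ 1 / (Real.pi * τ) * (μ * N + Real.sqrt (1 + τ ^ 2) / (t * μ)) * Real.exp (-μ * t) := by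
  have hτ := h.tau_pos
  have hμ := h.mu_pos
  have hN0 : 0 ≤ N := (norm_nonneg _).trans (hN 0 (by simp; positivity))
  set q := Real.sqrt (1 + τ ^ 2) with hq
  have hq0 : 0 ≤ q := Real.sqrt_nonneg _
  have hneg : -(t * τ) < 0 := by nlinarith [mul_pos ht hτ]
  set g₁ : ℝ → ℝ := (Icc (-(μ / τ)) (μ / τ)).indicator fun _ => N * Real.exp (-μ * t) with hg₁
  set g₂ : ℝ → ℝ := (Ioi (μ / τ)).indicator fun y => q / μ * Real.exp (-(t * τ) * y) with hg₂
  set g₃ : ℝ → ℝ := (Iic (-(μ / τ))).indicator fun y => q / μ * Real.exp ((t * τ) * y) with hg₃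
  have hi₁ : Integrable g₁ :=
    (integrable_indicator_iff measurableSet_Icc).2 (integrableOn_const measure_Icc_lt_top.ne)
  have hi₂ : Integrable g₂ := (integrable_indicator_iff measurableSet_Ioi).2
    ((integrableOn_exp_mul_Ioi hneg _).const_mul _)
  have hi₃ : Integrable g₃ := (integrable_indicator_iff measurableSet_Iic).2
    ((integrableOn_exp_mul_Iic (by positivity) _).const_mul _)
  have hp₁ : ∀ y, 0 ≤ g₁ y := fun y => indicator_nonneg (fun _ _ => by positivity) y
  have hp₂ : ∀ y, 0 ≤ g₂ y := fun y => indicator_nonneg (fun _ _ => by positivity) y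
  have hp₃ : ∀ y, 0 ≤ g₃ y := fun y => indicator_nonneg (fun _ _ => by positivity) y
  have hray : ∀ y, μ ≤ τ * |y| → ‖contourDeriv μ τ y • (Complex.exp (-(t : ℂ) * contour μ τ y) •
      invRes b (contour μ τ y))‖ ≤ q / μ * Real.exp (-(t * τ) * |y|) := by
    intro y hy
    rw [norm_smul, norm_smul, norm_exp_contour, max_eq_right hy]
    calc _ ≤ q * (Real.exp (-(t * (τ * |y|))) * (1 / μ)) := by
          have h1 := norm_contourDeriv_le_sqrt (μ := μ) (τ := τ) y
          have h2 : ‖invRes b (contour μ τ y)‖ ≤ 1 / μ := (hrays y hy).trans (by gcongr)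
          gcongr
      _ = _ := by
        rw [show -(t * τ) * |y| = -(t * (τ * |y|)) by ring]
        ring
  have hpt : ∀ y, ‖contourDeriv μ τ y • (Complex.exp (-(t : ℂ) * contour μ τ y) •
      invRes b (contour μ τ y))‖ ≤ g₁ y + g₂ y + g₃ y := by
    intro y
    have a₁ := hp₁ y
    have a₂ := hp₂ y
    have a₃ := hp₃ y
    by_cases hy : |y| ≤ μ / τ
    · have e₁ : g₁ y = N * Real.exp (-μ * t) := indicator_of_mem (mem_Icc.2 (abs_le.1 hy)) _
      have hmax : max μ (τ * |y|) = μ := max_eq_left (by rw [le_div_iff₀ hτ] at hy; linarith)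
      have : ‖contourDeriv μ τ y • (Complex.exp (-(t : ℂ) * contour μ τ y) •
          invRes b (contour μ τ y))‖ ≤ g₁ y := by
        rw [norm_smul, norm_smul, norm_exp_contour, hmax, norm_contourDeriv_of_segment hτ hy,
          one_mul, e₁, mul_comm, show -(t * μ) = -μ * t by ring]
        gcongr
        exact hN y hy
      linarith
    · push Not at hy
      have hy' : μ ≤ τ * |y| := by rw [div_lt_iff₀ hτ] at hy; linarith
      have hb := hray y hy'
      rcases le_total 0 y with h0 | h0
      · rw [abs_of_nonneg h0] at hy hb
        have e₂ : g₂ y = q / μ * Real.exp (-(t * τ) * y) := indicator_of_mem hy _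
        linarith
      · rw [abs_of_nonpos h0] at hy hb
        have e₃ : g₃ y = q / μ * Real.exp ((t * τ) * y) :=
          indicator_of_mem (mem_Iic.2 (by linarith)) _
        rw [neg_mul_neg] at hb
        linarith
  have hbound := norm_integral_le_of_norm_le ((hi₁.add hi₂).add hi₃) (Eventually.of_forall hpt)
  have hexp : Real.exp (-(t * τ) * (μ / τ)) = Real.exp (-μ * t) := by
    congr 1; field_simp
  have hexp' : Real.exp ((t * τ) * -(μ / τ)) = Real.exp (-μ * t) := by
    congr 1; field_simp
  have v₁ : ∫ y, g₁ y = 2 * (μ / τ) * (N * Real.exp (-μ * t)) := by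
    rw [hg₁, integral_indicator measurableSet_Icc, setIntegral_const, Real.volume_real_Icc_of_le
      (by linarith [div_pos hμ hτ]), smul_eq_mul]
    ring
  have v₂ : ∫ y, g₂ y = q / μ * (Real.exp (-μ * t) / (t * τ)) := by
    rw [hg₂, integral_indicator measurableSet_Ioi, integral_const_mul, integral_exp_mul_Ioi hneg,
      hexp, neg_div_neg_eq]
  have v₃ : ∫ y, g₃ y = q / μ * (Real.exp (-μ * t) / (t * τ)) := by
    rw [hg₃, integral_indicator measurableSet_Iic, integral_const_mul,
      integral_exp_mul_Iic (by positivity), hexp']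
  rw [integral_add' (hi₁.add hi₂) hi₃, integral_add' hi₁ hi₂, v₁, v₂, v₃] at hbound
  rw [semigroupIntegral, norm_smul, norm_inv, contourIntegral]
  have hnorm : ‖(2 * Real.pi * Complex.I : ℂ)‖ = 2 * Real.pi := by
    simp [abs_of_pos Real.pi_pos]
  rw [hnorm]
  have hpi := Real.pi_pos
  refine (mul_le_mul_of_nonneg_left hbound (by positivity)).trans_eq ?_
  field_simp
  ring

variable [CompleteSpace 𝔸]

theorem IsAdmissibleContour.continuous_invRes (h : IsAdmissibleContour b μ τ M) :
    Continuous fun y => invRes b (contour μ τ y) := by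
  simpa using continuous_invRes_contour h.subset le_rfl

theorem IsAdmissibleContour.continuous_semigroup_integrand (h : IsAdmissibleContour b μ τ M)
    (t : ℝ) : Continuous fun y =>
      Complex.exp (-(t : ℂ) * contour μ τ y) • invRes b (contour μ τ y) :=
  (continuous_exp_contour t).smul h.continuous_invRes

theorem IsAdmissibleContour.continuous_generator_integrand (h : IsAdmissibleContour b μ τ M)
    (t : ℝ) : Continuous fun y =>
      (contour μ τ y * Complex.exp (-(t : ℂ) * contour μ τ y)) • invRes b (contour μ τ y) :=
  (continuous_contour.mul (continuous_exp_contour t)).smul h.continuous_invRes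

theorem IsAdmissibleContour.hasDerivAt_semigroupIntegral (h : IsAdmissibleContour b μ τ M)
    {t : ℝ} (ht : 0 < t) :
    HasDerivAt (semigroupIntegral b μ τ) (-generatorIntegral b μ τ t) t := by
  obtain ⟨K, hK⟩ := h.exists_bound (half_pos ht)
  have h1 := hasDerivAt_contourIntegral h.tau_pos (x₀ := t) (Ioi_mem_nhds (half_lt_self ht)) (K := K)
    (f := fun t z => Complex.exp (-(t : ℂ) * z) • invRes b z)
    (f' := fun t z => -((z * Complex.exp (-(t : ℂ) * z)) • invRes b z))
    (fun t _ => h.continuous_semigroup_integrand t)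
    (fun y => (hK t (half_le_self ht.le) y).1)
    (h.continuous_generator_integrand t).neg
    (fun t ht y => by rw [norm_neg]; exact (hK t (le_of_lt ht) y).2) (fun s _ y => ?_)
  · have h2 : contourIntegral μ τ (fun z => -((z * Complex.exp (-(t : ℂ) * z)) • invRes b z))
        = -contourIntegral μ τ (fun z => (z * Complex.exp (-(t : ℂ) * z)) • invRes b z) := by
      simp only [contourIntegral, smul_neg, integral_neg]
    rw [h2] at h1
    exact (h1.fun_const_smul (2 * Real.pi * Complex.I : ℂ)⁻¹).congr_deriv (smul_neg _ _)
  · have h4 : HasDerivAt (fun t : ℝ => -(t : ℂ) * contour μ τ y) (-1 * contour μ τ y) s :=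
      (Complex.ofRealCLM.hasDerivAt (x := s)).fun_neg.mul_const _
    refine (h4.cexp.smul_const (invRes b (contour μ τ y))).congr_deriv ?_
    rw [← neg_smul]
    congr 1
    ring

theorem IsAdmissibleContour.integrable_semigroup (h : IsAdmissibleContour b μ τ M)
    {t : ℝ} (ht : 0 < t) : Integrable fun y => contourDeriv μ τ y •
      (Complex.exp (-(t : ℂ) * contour μ τ y) • invRes b (contour μ τ y)) := by
  obtain ⟨K, hK⟩ := h.exists_bound ht
  exact integrable_contour h.tau_pos (f := fun z => Complex.exp (-(t : ℂ) * z) • invRes b z)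
    (h.continuous_semigroup_integrand t) fun y => (hK t le_rfl y).1

theorem IsAdmissibleContour.integrable_generator (h : IsAdmissibleContour b μ τ M)
    {t : ℝ} (ht : 0 < t) : Integrable fun y => contourDeriv μ τ y •
      ((contour μ τ y * Complex.exp (-(t : ℂ) * contour μ τ y)) • invRes b (contour μ τ y)) := by
  obtain ⟨K, hK⟩ := h.exists_bound ht
  exact integrable_contour h.tau_pos
    (f := fun z => (z * Complex.exp (-(t : ℂ) * z)) • invRes b z)
    (h.continuous_generator_integrand t) fun y => (hK t le_rfl y).2

theorem IsAdmissibleContour.commute_semigroupIntegral (h : IsAdmissibleContour b μ τ M)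
    {t : ℝ} (ht : 0 < t) : Commute b (semigroupIntegral b μ τ t) := by
  refine Commute.smul_right ?_ _
  change b * _ = _ * b
  rw [contourIntegral, ← integral_const_mul_of_integrable (h.integrable_semigroup ht),
    ← integral_mul_const_of_integrable (h.integrable_semigroup ht)]
  congr 1
  funext y
  rw [mul_smul_comm, mul_smul_comm, smul_mul_assoc, smul_mul_assoc, (commute_invRes b _).eq]

theorem IsAdmissibleContour.commute_generatorIntegral (h : IsAdmissibleContour b μ τ M)
    {t : ℝ} (ht : 0 < t) : Commute b (generatorIntegral b μ τ t) := by
  refine Commute.smul_right ?_ _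
  change b * _ = _ * b
  rw [contourIntegral, ← integral_const_mul_of_integrable (h.integrable_generator ht),
    ← integral_mul_const_of_integrable (h.integrable_generator ht)]
  congr 1
  funext y
  rw [mul_smul_comm, mul_smul_comm, smul_mul_assoc, smul_mul_assoc, (commute_invRes b _).eq]

theorem IsAdmissibleContour.mul_generatorIntegral (h : IsAdmissibleContour b μ τ M)
    {t : ℝ} (ht : 0 < t) : b * generatorIntegral b μ τ t = semigroupIntegral b μ τ t := by
  rw [generatorIntegral, semigroupIntegral, mul_smul_comm]
  congr 1
  rw [contourIntegral, ← integral_const_mul_of_integrable (h.integrable_generator ht)]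
  obtain ⟨K, -, hK⟩ := exists_bound_exp_contour h.tau_pos h.mu_pos ht
  have hint : Integrable fun y => contourDeriv μ τ y •
      Complex.exp (-(t : ℂ) * contour μ τ y) :=
    integrable_contour h.tau_pos (f := fun z => Complex.exp (-(t : ℂ) * z))
      (continuous_exp_contour t) fun y => (hK t le_rfl y).1
  have e : (fun y => b * (contourDeriv μ τ y •
      ((contour μ τ y * Complex.exp (-(t : ℂ) * contour μ τ y)) • invRes b (contour μ τ y))))
      = fun y => contourDeriv μ τ y •
        (Complex.exp (-(t : ℂ) * contour μ τ y) • invRes b (contour μ τ y))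
        - (contourDeriv μ τ y • Complex.exp (-(t : ℂ) * contour μ τ y)) • b := by
    funext y
    have h1 := smul_mul_invRes (h.subset (contour_mem_leftRegion y))
    rw [mul_smul_comm, mul_smul_comm, mul_comm (contour μ τ y), mul_smul, h1, smul_sub, smul_sub,
      smul_assoc]
  have h0 := contourIntegral_exp h.tau_pos h.mu_pos ht
  rw [contourIntegral] at h0
  rw [e, integral_sub (h.integrable_semigroup ht) (hint.smul_const b), integral_smul_const, h0,
    zero_smul, sub_zero, contourIntegral]

/-- The contour integral for `e^{-tA}` converges to the identity on the domain of `A`. By the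
resolvent identity it is the sum of a scalar integral, which is evaluated by residues, and of an
absolutely convergent integral that vanishes for `t = 0`. -/
theorem IsAdmissibleContour.tendsto_semigroupIntegral_mul (h : IsAdmissibleContour b μ τ M) :
    Tendsto (fun t => semigroupIntegral b μ τ t * b) (𝓝[>] 0) (𝓝 b) := by
  obtain ⟨k, hk, hkle⟩ := exists_bound_sub_leftRegion h.tau_pos h.mu_pos
  have hM := h.bound_nonneg
  set c : ℝ := μ + 1 with hc
  have hk' : ∀ y, k * (1 + |y|) ≤ ‖(c : ℂ) - contour μ τ y‖ := fun y => by
    simpa using hkle _ (contour_mem_leftRegion y)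
  have hsub : ∀ y, (c : ℂ) - contour μ τ y ≠ 0 := fun y =>
    norm_pos_iff.1 (lt_of_lt_of_le (by positivity) (hk' y))
  have hinvc : Continuous fun y => ((c : ℂ) - contour μ τ y)⁻¹ :=
    (continuous_const.sub continuous_contour).inv₀ hsub
  have hadd := contour_add_one_ne_zero (τ := τ) h.mu_pos
  have haddc : Continuous fun y => (contour μ τ y + 1)⁻¹ :=
    (continuous_contour.add continuous_const).inv₀ hadd
  have hinv : ∀ y, ‖((c : ℂ) - contour μ τ y)⁻¹‖ ≤ 1 / k * (1 + |y|)⁻¹ := fun y => by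
    rw [norm_inv, one_div, ← mul_inv]
    have := hk' y
    gcongr
  have hexp1 : ∀ t : ℝ, 0 < t → ∀ y, ‖Complex.exp (-(t : ℂ) * contour μ τ y)‖ ≤ 1 := by
    intro t ht y
    rw [norm_exp_contour, Real.exp_le_one_iff]
    have : 0 < max μ (τ * |y|) := lt_max_of_lt_left h.mu_pos
    have := mul_pos ht this
    linarith
  have hexp0 : ∀ y, Tendsto (fun t : ℝ => Complex.exp (-(t : ℂ) * contour μ τ y)) (𝓝[>] 0)
      (𝓝 1) := fun y => by
    have : Continuous fun t : ℝ => Complex.exp (-(t : ℂ) * contour μ τ y) := by fun_prop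
    simpa using (this.tendsto 0).mono_left nhdsWithin_le_nhds
  -- the operator valued part
  set G : ℝ → ℂ → 𝔸 := fun t z => Complex.exp (-(t : ℂ) * z) • ((c - z)⁻¹ • invRes b z) with hG
  have hGc : ∀ t, Continuous fun y => G t (contour μ τ y) := fun t =>
    (continuous_exp_contour t).smul (hinvc.smul h.continuous_invRes)
  have hGb : ∀ t : ℝ, 0 < t → ∀ y, ‖G t (contour μ τ y)‖ ≤ M / k * (1 + y ^ 2)⁻¹ := by
    intro t ht y
    have h0 := abs_nonneg y
    have hR := h.norm_le _ (contour_mem_leftRegion y)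
    rw [contour_im] at hR
    calc ‖G t (contour μ τ y)‖ ≤ 1 * (1 / k * (1 + |y|)⁻¹ * (M / (1 + |y|))) := by
          rw [hG, norm_smul, norm_smul]
          have h1 := hinv y
          have h2 := hexp1 t ht y
          gcongr
      _ = M / k * ((1 + |y|) ^ 2)⁻¹ := by field_simp
      _ ≤ M / k * (1 + y ^ 2)⁻¹ :=
        mul_le_mul_of_nonneg_left (inv_one_add_abs_sq_le y) (by positivity)
  have hGlim : Tendsto (fun t => contourIntegral μ τ (G t)) (𝓝[>] 0) (𝓝 0) := by
    rw [← contourIntegral_invRes_div h.tau_pos h.mu_pos h.subset hM h.norm_le]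
    refine tendsto_contourIntegral h.tau_pos (K := M / k) (Eventually.of_forall hGc)
      (eventually_nhdsWithin_of_forall hGb) fun y => ?_
    have h1 := (hexp0 y).smul_const (((c : ℂ) - contour μ τ y)⁻¹ • invRes b (contour μ τ y))
    rwa [one_smul] at h1
  -- the scalar part
  set S : ℝ → ℂ → ℂ := fun t z => Complex.exp (-(t : ℂ) * z) * (c - z)⁻¹ with hS
  have hSint : ∀ t : ℝ, 0 < t → Integrable fun y => contourDeriv μ τ y • S t (contour μ τ y) := by
    intro t ht
    obtain ⟨K, hK0, hK⟩ := exists_bound_exp_contour h.tau_pos h.mu_pos ht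
    refine integrable_contour h.tau_pos ((continuous_exp_contour t).mul hinvc) (K := K * (1 / k))
      fun y => ?_
    rw [norm_mul, mul_right_comm]
    refine mul_le_mul (hK t le_rfl y).1 ((hinv y).trans (mul_le_of_le_one_right (by positivity)
      (inv_le_one_of_one_le₀ (by linarith [abs_nonneg y])))) (norm_nonneg _) (by positivity)
  have hSeq : ∀ t : ℝ, 0 < t → contourIntegral μ τ (S t)
      = contourIntegral μ τ (fun z => Complex.exp (-(t : ℂ) * z) * ((z + 1)⁻¹ + (c - z)⁻¹)) := by
    intro t ht
    obtain ⟨K, hK0, hK⟩ := exists_bound_exp_contour h.tau_pos h.mu_pos ht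
    have h2 : Integrable fun y => contourDeriv μ τ y •
        (Complex.exp (-(t : ℂ) * contour μ τ y) / (contour μ τ y + 1)) := by
      refine integrable_contour h.tau_pos (f := fun z => Complex.exp (-(t : ℂ) * z) / (z + 1))
        ((continuous_exp_contour t).div (continuous_contour.add continuous_const) hadd) (K := K)
        fun y => ?_
      rw [norm_div]
      exact (div_le_self (norm_nonneg _) (one_le_norm_contour_add_one h.mu_pos y)).trans
        (hK t le_rfl y).1
    have h3 := contourIntegral_exp_div_add_one h.tau_pos h.mu_pos ht
    have h4 := integral_add h2 (hSint t ht)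
    simp only [contourIntegral] at h3 ⊢
    rw [h3, zero_add] at h4
    rw [← h4]
    congr 1
    funext y
    simp only [hS, smul_eq_mul]
    ring
  have hSlim : Tendsto (fun t => contourIntegral μ τ (S t)) (𝓝[>] 0)
      (𝓝 (2 * Real.pi * Complex.I)) := by
    rw [← contourIntegral_add_one_inv h.tau_pos h.mu_pos]
    obtain ⟨K, hb⟩ := exists_bound_add_one_inv h.tau_pos h.mu_pos
    have h5 : Tendsto (fun t : ℝ => contourIntegral μ τ
        (fun z => Complex.exp (-(t : ℂ) * z) * ((z + 1)⁻¹ + (c - z)⁻¹))) (𝓝[>] 0)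
        (𝓝 (contourIntegral μ τ (fun z => (z + 1)⁻¹ + ((c : ℂ) - z)⁻¹))) := by
      refine tendsto_contourIntegral h.tau_pos (K := K)
        (Eventually.of_forall fun t => (continuous_exp_contour t).mul (haddc.add hinvc))
        (eventually_nhdsWithin_of_forall fun t ht y => ?_) fun y => ?_
      · rw [norm_mul]
        exact (mul_le_of_le_one_left (norm_nonneg _) (hexp1 t ht y)).trans (hb y)
      · simpa using (hexp0 y).mul_const ((contour μ τ y + 1)⁻¹ + ((c : ℂ) - contour μ τ y)⁻¹)
    exact h5.congr' (eventually_nhdsWithin_of_forall fun t ht => (hSeq t ht).symm)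
  have hpi : (2 * Real.pi * Complex.I : ℂ) ≠ 0 := Complex.two_pi_I_ne_zero
  have hmain : Tendsto (fun t => (2 * Real.pi * Complex.I : ℂ)⁻¹ • (contourIntegral μ τ (S t) • b
      - contourIntegral μ τ (G t) * (1 - (c : ℂ) • b))) (𝓝[>] 0) (𝓝 b) := by
    have := ((hSlim.smul_const b).sub (hGlim.mul_const (1 - (c : ℂ) • b))).const_smul
      (2 * Real.pi * Complex.I : ℂ)⁻¹
    rwa [zero_mul, sub_zero, inv_smul_smul₀ hpi] at this
  refine hmain.congr' (eventually_nhdsWithin_of_forall fun t ht => ?_)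
  have hGint : Integrable fun y => contourDeriv μ τ y • G t (contour μ τ y) :=
    integrable_contour h.tau_pos (hGc t) (hGb t ht)
  simp only [semigroupIntegral, contourIntegral]
  rw [smul_mul_assoc, ← integral_mul_const_of_integrable (h.integrable_semigroup ht),
    ← integral_mul_const_of_integrable hGint, ← integral_smul_const, ← integral_sub
      ((hSint t ht).smul_const b) (hGint.mul_const _)]
  congr 2
  funext y
  have h6 := invRes_mul_eq (c := (c : ℂ)) (h.subset (contour_mem_leftRegion y)) (hsub y)
  simp only [hS, hG, smul_mul_assoc] at h6 ⊢
  rw [h6, smul_sub, smul_sub]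
  simp only [smul_smul, smul_eq_mul]

end SemigroupIntegral

/-! ### Accretive evolution equations -/

section Energy

variable {X : Type*} [NormedAddCommGroup X] [InnerProductSpace ℂ X] {B : X →L[ℂ] X}

/-- Solutions of `w' = -A w`, with `A = B⁻¹` accretive, do not increase in norm. The equation is
written with `v = A w`, and only right derivatives are needed. -/
theorem norm_le_of_hasDerivWithinAt (hB : ∀ y, 0 ≤ (inner ℂ (B y) y).re) {w v : ℝ → X} {a b : ℝ}
    (hab : a ≤ b) (hc : ContinuousOn w (Icc a b))
    (hd : ∀ t ∈ Ico a b, HasDerivWithinAt w (-v t) (Ici t) t) (hw : ∀ t ∈ Ico a b, w t = B (v t)) :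
    ‖w b‖ ≤ ‖w a‖ := by
  have hsq : ∀ x : X, (inner ℂ x x).re = ‖x‖ ^ 2 := fun x => by
    rw [inner_self_eq_norm_sq_to_K]
    norm_cast
  have key := image_le_of_deriv_right_le_deriv_boundary (f := fun t => ‖w t‖ ^ 2)
    (f' := fun t => (inner ℂ (w t) (-v t) + inner ℂ (-v t) (w t)).re)
    (B := fun _ => ‖w a‖ ^ 2) (B' := fun _ => 0) (hc.norm.pow 2) (fun t ht => ?_) le_rfl
    continuousOn_const (fun t _ => hasDerivWithinAt_const _ _ _) (fun t ht => ?_)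
    (right_mem_Icc.2 hab)
  · exact le_of_sq_le_sq key (norm_nonneg _)
  · have h1 := ((hd t ht).inner ℂ (hd t ht))
    have h2 := Complex.reCLM.hasFDerivAt.comp_hasDerivWithinAt t h1
    refine HasDerivWithinAt.congr_deriv (h2.congr (fun s _ => ?_) ?_) rfl
    · exact (hsq (w s)).symm
    · exact (hsq (w t)).symm
  · have h1 := hB (v t)
    rw [← hw t ht] at h1
    have h2 : (inner ℂ (v t) (w t)).re = (inner ℂ (w t) (v t)).re := by
      rw [← inner_conj_symm, Complex.conj_re]
    simp only [inner_neg_left, inner_neg_right, Complex.add_re, Complex.neg_re, h2]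
    linarith

theorem hasDerivAt_apply {S : ℝ → X →L[ℂ] X} {S' : X →L[ℂ] X} {t : ℝ} (hS : HasDerivAt S S' t)
    (x : X) : HasDerivAt (fun t => S t x) (S' x) t :=
  ((ContinuousLinearMap.apply ℂ X x).restrictScalars ℝ).hasFDerivAt.comp_hasDerivAt t hS

theorem tendsto_apply {ι : Type*} {l : Filter ι} {S : ι → X →L[ℂ] X} {S₀ : X →L[ℂ] X}
    (hS : Tendsto S l (𝓝 S₀)) (x : X) : Tendsto (fun i => S i x) l (𝓝 (S₀ x)) :=
  ((ContinuousLinearMap.apply ℂ X x).continuous.tendsto S₀).comp hS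

end Energy

/-! ### Generation and uniqueness of the semigroup -/

section Semigroup

variable {X : Type*} [NormedAddCommGroup X] [InnerProductSpace ℂ X] [CompleteSpace X]
variable {B : X →L[ℂ] X} {μ τ M : ℝ}

/-- The operators `e^{-tA}` for `t ≥ 0`, where `A = B⁻¹`. The contour integral does not converge
absolutely for `t = 0`, where the identity is put in by hand; the value for `t < 0` has no meaning. -/
noncomputable def semigroup (B : X →L[ℂ] X) (μ τ t : ℝ) : X →L[ℂ] X :=
  if 0 < t then semigroupIntegral B μ τ t else 1

theorem semigroup_of_pos {t : ℝ} (ht : 0 < t) : semigroup B μ τ t = semigroupIntegral B μ τ t :=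
  if_pos ht

theorem semigroup_zero : semigroup B μ τ 0 = 1 := if_neg (lt_irrefl 0)

theorem IsAdmissibleContour.commute_semigroup (h : IsAdmissibleContour B μ τ M) (t : ℝ) :
    Commute B (semigroup B μ τ t) := by
  by_cases ht : 0 < t
  · rw [semigroup_of_pos ht]; exact h.commute_semigroupIntegral ht
  · rw [semigroup, if_neg ht]; exact Commute.one_right B

theorem IsAdmissibleContour.apply_semigroup (h : IsAdmissibleContour B μ τ M) (t : ℝ) (x : X) :
    B (semigroup B μ τ t x) = semigroup B μ τ t (B x) :=
  congrArg (fun T : X →L[ℂ] X => T x) (h.commute_semigroup t).eq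

theorem IsAdmissibleContour.hasDerivAt_semigroup (h : IsAdmissibleContour B μ τ M)
    {t : ℝ} (ht : 0 < t) : HasDerivAt (semigroup B μ τ) (-generatorIntegral B μ τ t) t := by
  refine (h.hasDerivAt_semigroupIntegral ht).congr_of_eventuallyEq ?_
  filter_upwards [Ioi_mem_nhds ht] with s hs using semigroup_of_pos hs

theorem IsAdmissibleContour.hasDerivAt_semigroup_mul (h : IsAdmissibleContour B μ τ M)
    {t : ℝ} (ht : 0 < t) :
    HasDerivAt (fun t => semigroup B μ τ t * B) (-semigroup B μ τ t) t := by
  refine ((h.hasDerivAt_semigroup ht).mul_const B).congr_deriv ?_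
  rw [neg_mul, ← (h.commute_generatorIntegral ht).eq, h.mul_generatorIntegral ht,
    semigroup_of_pos ht]

theorem IsAdmissibleContour.tendsto_semigroup_mul (h : IsAdmissibleContour B μ τ M) :
    Tendsto (fun t => semigroup B μ τ t * B) (𝓝[>] 0) (𝓝 B) :=
  h.tendsto_semigroupIntegral_mul.congr' (eventually_nhdsWithin_of_forall fun t ht => by
    simp only [semigroup_of_pos (show 0 < t from ht)])

theorem IsAdmissibleContour.norm_semigroup_le_one (h : IsAdmissibleContour B μ τ M)
    (hB : ∀ y, 0 ≤ (inner ℂ (B y) y).re) (hd : DenseRange B) {t : ℝ} (ht : 0 ≤ t) :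
    ‖semigroup B μ τ t‖ ≤ 1 := by
  rcases ht.eq_or_lt with rfl | ht
  · rw [semigroup_zero]
    exact ContinuousLinearMap.norm_id_le
  refine ContinuousLinearMap.opNorm_le_bound _ zero_le_one fun x => ?_
  rw [one_mul]
  refine hd.induction_on (p := fun x => ‖semigroup B μ τ t x‖ ≤ ‖x‖) x
    (isClosed_le (by fun_prop) (by fun_prop)) fun y => ?_
  have h1 : ∀ a, 0 < a → a ≤ t → ‖semigroup B μ τ t (B y)‖ ≤ ‖semigroup B μ τ a (B y)‖ := by
    intro a ha hat
    have hder : ∀ s, 0 < s → HasDerivAt (fun s => semigroup B μ τ s (B y))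
        (-semigroup B μ τ s y) s := fun s hs => hasDerivAt_apply (h.hasDerivAt_semigroup_mul hs) y
    exact norm_le_of_hasDerivWithinAt hB (w := fun s => semigroup B μ τ s (B y))
      (v := fun s => semigroup B μ τ s y) hat
      (fun s hs => (hder s (ha.trans_le hs.1)).continuousAt.continuousWithinAt)
      (fun s hs => (hder s (ha.trans_le hs.1)).hasDerivWithinAt)
      (fun s _ => (h.apply_semigroup s y).symm)
  refine ge_of_tendsto (tendsto_apply h.tendsto_semigroup_mul y).norm ?_
  filter_upwards [Ioc_mem_nhdsGT ht] with a ha using h1 a ha.1 ha.2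

theorem IsAdmissibleContour.tendsto_semigroup (h : IsAdmissibleContour B μ τ M)
    (hB : ∀ y, 0 ≤ (inner ℂ (B y) y).re) (hd : DenseRange B) (x : X) :
    Tendsto (fun t => semigroup B μ τ t x) (𝓝[>] 0) (𝓝 x) := by
  rw [Metric.tendsto_nhds]
  intro ε hε
  obtain ⟨y, hy⟩ := hd.exists_dist_lt x (show 0 < ε / 3 by positivity)
  have h1 := Metric.tendsto_nhds.1 (tendsto_apply h.tendsto_semigroup_mul y) (ε / 3) (by positivity)
  filter_upwards [h1, self_mem_nhdsWithin] with t ht ht0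
  have h2 : dist (semigroup B μ τ t x) (semigroup B μ τ t (B y)) ≤ dist x (B y) := by
    rw [dist_eq_norm, dist_eq_norm, ← map_sub]
    exact (ContinuousLinearMap.le_of_opNorm_le _ (h.norm_semigroup_le_one hB hd (le_of_lt ht0))
      _).trans_eq (one_mul _)
  have h3 : dist (semigroup B μ τ t (B y)) (B y) < ε / 3 := ht
  calc _ ≤ dist (semigroup B μ τ t x) (semigroup B μ τ t (B y))
        + dist (semigroup B μ τ t (B y)) (B y) + dist (B y) x := dist_triangle4 _ _ _ _
    _ < ε / 3 + ε / 3 + ε / 3 := by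
      rw [dist_comm (B y) x]
      gcongr
      exact h2.trans_lt hy
    _ = ε := by ring

theorem IsAdmissibleContour.continuousOn_semigroup (h : IsAdmissibleContour B μ τ M)
    (hB : ∀ y, 0 ≤ (inner ℂ (B y) y).re) (hd : DenseRange B) (x : X) :
    ContinuousOn (fun t => semigroup B μ τ t x) (Ici 0) := by
  intro t ht
  rcases (show 0 ≤ t from ht).eq_or_lt with rfl | ht
  · rw [← continuousWithinAt_Ioi_iff_Ici, ContinuousWithinAt, semigroup_zero]
    exact h.tendsto_semigroup hB hd x
  · exact (hasDerivAt_apply (h.hasDerivAt_semigroup ht) x).continuousAt.continuousWithinAt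

theorem IsAdmissibleContour.hasDerivWithinAt_semigroup_apply (h : IsAdmissibleContour B μ τ M)
    (hB : ∀ y, 0 ≤ (inner ℂ (B y) y).re) (hd : DenseRange B) (y : X) {t : ℝ} (ht : 0 ≤ t) :
    HasDerivWithinAt (fun t => semigroup B μ τ t (B y)) (-semigroup B μ τ t y) (Ici t) t := by
  have hder : ∀ s, 0 < s → HasDerivAt (fun s => semigroup B μ τ s (B y))
      (-semigroup B μ τ s y) s := fun s hs => hasDerivAt_apply (h.hasDerivAt_semigroup_mul hs) y
  rcases ht.eq_or_lt with rfl | ht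
  · refine hasDerivWithinAt_Ici_of_tendsto_deriv (s := Ioi 0)
      (fun s hs => (hder s hs).differentiableAt.differentiableWithinAt)
      ((h.continuousOn_semigroup hB hd (B y) 0 (by simp)).mono Ioi_subset_Ici_self)
      self_mem_nhdsWithin ?_
    rw [semigroup_zero]
    exact (h.tendsto_semigroup hB hd y).neg.congr' (eventually_nhdsWithin_of_forall fun s hs =>
      (hder s hs).deriv.symm)
  · exact (hder t ht).hasDerivWithinAt

theorem IsAdmissibleContour.semigroup_add (h : IsAdmissibleContour B μ τ M)
    (hB : ∀ y, 0 ≤ (inner ℂ (B y) y).re) (hd : DenseRange B) {s t : ℝ} (hs : 0 ≤ s) (ht : 0 ≤ t) :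
    semigroup B μ τ (s + t) = (semigroup B μ τ s).comp (semigroup B μ τ t) := by
  rcases ht.eq_or_lt with rfl | ht
  · rw [add_zero, semigroup_zero]; rfl
  ext x
  rw [ContinuousLinearMap.comp_apply]
  -- both sides solve the same equation in `s`, with the initial value `B v`
  set v := generatorIntegral B μ τ t x with hv
  have hx : semigroup B μ τ t x = B v := by
    rw [semigroup_of_pos ht, ← h.mul_generatorIntegral ht]; rfl
  have key := norm_le_of_hasDerivWithinAt hB
    (w := fun r => semigroup B μ τ (r + t) x - semigroup B μ τ r (semigroup B μ τ t x))
    (v := fun r => generatorIntegral B μ τ (r + t) x - semigroup B μ τ r v) hs ?_ ?_ ?_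
  · simp only [zero_add, semigroup_zero] at key
    rw [show (1 : X →L[ℂ] X) (semigroup B μ τ t x) = semigroup B μ τ t x from rfl, sub_self,
      norm_zero] at key
    exact sub_eq_zero.1 (norm_le_zero_iff.1 key)
  · refine ContinuousOn.sub ?_ ((h.continuousOn_semigroup hB hd _).mono fun r hr => hr.1)
    exact (h.continuousOn_semigroup hB hd x).comp (by fun_prop) fun r hr =>
      add_nonneg hr.1 ht.le
  · intro r hr
    have hrt : 0 < r + t := add_pos_of_nonneg_of_pos hr.1 ht
    have h1 := (hasDerivAt_apply (h.hasDerivAt_semigroup hrt) x).comp_add_const r t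
    have h2 := h.hasDerivWithinAt_semigroup_apply hB hd v hr.1
    rw [hx]
    refine (h1.hasDerivWithinAt.sub h2).congr_deriv ?_
    rw [neg_apply]
    abel
  · intro r hr
    have hrt : 0 < r + t := add_pos_of_nonneg_of_pos hr.1 ht
    rw [map_sub, h.apply_semigroup, hx, semigroup_of_pos hrt, ← h.mul_generatorIntegral hrt]
    rfl

variable {A : X →ₗ.[ℂ] X}

theorem IsAdmissibleContour.isSemigroupGeneratedByNeg (h : IsAdmissibleContour B μ τ M)
    (hB : ∀ y, 0 ≤ (inner ℂ (B y) y).re) (hd : DenseRange B)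
    (hAB : ∀ x y, (x, y) ∈ A.graph ↔ x = B y) :
    A.IsSemigroupGeneratedByNeg (semigroup B μ τ) where
  map_zero := semigroup_zero
  map_add _ _ hs ht := h.semigroup_add hB hd hs ht
  strong_continuity := h.tendsto_semigroup hB hd
  generator x y := by
    have hlim : ∀ y, Tendsto (fun t : ℝ => (t⁻¹ : ℝ) • (semigroup B μ τ t (B y) - B y)) (𝓝[>] 0)
        (𝓝 (-y)) := by
      intro y
      have h1 := (h.hasDerivWithinAt_semigroup_apply hB hd y le_rfl)
      rw [hasDerivWithinAt_iff_tendsto_slope, Ici_sdiff_left, semigroup_zero] at h1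
      refine h1.congr fun t => ?_
      rw [slope_def_module, sub_zero, semigroup_zero]
      rfl
    rw [hAB]
    refine ⟨?_, fun hxy => ?_⟩
    · rintro rfl
      exact hlim y
    · -- `x = B y` follows by applying `B` to the difference quotients of `x`, since those of `B x`
      -- converge to `-x`
      have h1 : Tendsto (fun t : ℝ => B ((t⁻¹ : ℝ) • (semigroup B μ τ t x - x))) (𝓝[>] 0)
          (𝓝 (B (-y))) := (B.continuous.tendsto _).comp hxy
      have h2 := tendsto_nhds_unique (h1.congr fun t => ?_) (hlim x)
      · rw [map_neg] at h2
        exact (neg_injective h2).symm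
      · rw [← h.apply_semigroup, ← map_sub]
        exact ((B.restrictScalars ℝ).map_smul _ _)

/-- A strongly continuous semigroup is bounded near `t = 0`, by the Banach–Steinhaus theorem. -/
theorem exists_bound_of_isSemigroupGeneratedByNeg {S : ℝ → X →L[ℂ] X}
    (hS : A.IsSemigroupGeneratedByNeg S) :
    ∃ δ : ℝ, 0 < δ ∧ ∃ K : ℝ, 0 ≤ K ∧ ∀ t ∈ Icc 0 δ, ‖S t‖ ≤ K := by
  by_contra! hcon
  have h1 : ∀ n : ℕ, ∃ t ∈ Icc (0 : ℝ) (1 / (n + 1)), (n : ℝ) < ‖S t‖ := fun n =>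
    hcon _ Nat.one_div_pos_of_nat _ n.cast_nonneg
  choose t ht htn using h1
  have ht0 : Tendsto t atTop (𝓝 0) := squeeze_zero (fun n => (ht n).1) (fun n => (ht n).2)
    tendsto_one_div_add_atTop_nhds_zero_nat
  have h2 : ∀ x, Tendsto (fun n => S (t n) x) atTop (𝓝 x) := fun x => by
    have h3 : Tendsto (fun t => S t x) (𝓝[≥] 0) (𝓝 x) := by
      have h4 : ContinuousWithinAt (fun t => S t x) (Ici 0) 0 := by
        rw [← continuousWithinAt_Ioi_iff_Ici, ContinuousWithinAt, hS.map_zero]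
        exact hS.strong_continuity x
      simpa [ContinuousWithinAt, hS.map_zero] using h4
    exact h3.comp (tendsto_nhdsWithin_iff.2 ⟨ht0, Eventually.of_forall fun n => (ht n).1⟩)
  obtain ⟨C, hC⟩ := banach_steinhaus (g := fun n => S (t n)) fun x => by
    obtain ⟨C, hC⟩ := (h2 x).norm.bddAbove_range
    exact ⟨C, fun n => hC ⟨n, rfl⟩⟩
  obtain ⟨n, hn⟩ := exists_nat_gt C
  linarith [hC n, htn n]

theorem exists_bound_Icc_of_isSemigroupGeneratedByNeg {S : ℝ → X →L[ℂ] X}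
    (hS : A.IsSemigroupGeneratedByNeg S) (r : ℝ) : ∃ K : ℝ, 0 ≤ K ∧ ∀ t ∈ Icc 0 r, ‖S t‖ ≤ K := by
  obtain ⟨δ, hδ, K, hK, hb⟩ := exists_bound_of_isSemigroupGeneratedByNeg hS
  have h1 : ∀ n : ℕ, ∃ K : ℝ, 0 ≤ K ∧ ∀ t ∈ Icc 0 (n * δ), ‖S t‖ ≤ K := by
    intro n
    induction n with
    | zero => exact ⟨K, hK, fun t ht => hb t ⟨ht.1, ht.2.trans (by simpa using hδ.le)⟩⟩
    | succ n ih =>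
      obtain ⟨K', hK', hb'⟩ := ih
      refine ⟨K' + K' * K, by positivity, fun t ht => ?_⟩
      rcases le_total t (n * δ) with h | h
      · exact (hb' t ⟨ht.1, h⟩).trans (by linarith [mul_nonneg hK' hK])
      · have h0 : (0 : ℝ) ≤ n * δ := by positivity
        have h2 : t = n * δ + (t - n * δ) := by ring
        have h3 : t - n * δ ≤ δ := by
          have := ht.2
          push_cast at this
          linarith
        rw [h2, hS.map_add _ _ h0 (by linarith)]
        refine (ContinuousLinearMap.opNorm_comp_le _ _).trans ?_
        have := mul_le_mul (hb' (n * δ) ⟨h0, le_rfl⟩) (hb (t - n * δ) ⟨by linarith, h3⟩)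
          (norm_nonneg _) hK'
        linarith
  obtain ⟨n, hn⟩ := exists_nat_ge (r / δ)
  obtain ⟨K', hK', hb'⟩ := h1 n
  exact ⟨K', hK', fun t ht => hb' t ⟨ht.1, ht.2.trans ((div_le_iff₀ hδ).1 hn)⟩⟩

/-- Continuity from the left, which strong continuity at `0` does not give directly, comes from the
local bound. -/
theorem continuousOn_of_isSemigroupGeneratedByNeg {S : ℝ → X →L[ℂ] X}
    (hS : A.IsSemigroupGeneratedByNeg S) (x : X) : ContinuousOn (fun t => S t x) (Ici 0) := by
  intro t ht
  have ht : 0 ≤ t := ht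
  obtain ⟨K, hK, hb⟩ := exists_bound_Icc_of_isSemigroupGeneratedByNeg hS (t + 1)
  rw [Metric.continuousWithinAt_iff]
  intro ε hε
  have h1 := hS.strong_continuity x
  rw [Metric.tendsto_nhdsWithin_nhds] at h1
  obtain ⟨δ, hδ, h2⟩ := h1 (ε / (K + 1)) (by positivity)
  -- both one-sided increments are `S r (S h x - x)` with `r ≤ t + 1`
  have h3 : ∀ r s, 0 ≤ r → r < s → s ≤ t + 1 → s - r < δ → ‖S s x - S r x‖ < ε := by
    intro r s hr hrs hst hd
    have e : S s x - S r x = S r (S (s - r) x - x) := by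
      rw [map_sub]
      conv_lhs => rw [show s = r + (s - r) by ring, hS.map_add _ _ hr (by linarith)]
      rfl
    have h4 := h2 (x := s - r) (show 0 < s - r by linarith)
      (by rw [Real.dist_eq, sub_zero, abs_of_pos (by linarith)]; exact hd)
    rw [dist_eq_norm] at h4
    rw [e]
    calc ‖S r (S (s - r) x - x)‖ ≤ K * ‖S (s - r) x - x‖ :=
          ContinuousLinearMap.le_of_opNorm_le _ (hb r ⟨hr, by linarith⟩) _
      _ ≤ K * (ε / (K + 1)) := by gcongr
      _ < ε := by
        rw [mul_div_assoc', div_lt_iff₀ (by positivity)]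
        nlinarith
  refine ⟨min δ 1, by positivity, fun s hs hst => ?_⟩
  have hs : 0 ≤ s := hs
  rw [Real.dist_eq] at hst
  have hst1 := hst.trans_le (min_le_left _ _)
  have hst2 := hst.trans_le (min_le_right _ _)
  rw [abs_lt] at hst1 hst2
  rcases lt_trichotomy s t with h | rfl | h
  · rw [dist_comm, dist_eq_norm]
    exact h3 s t hs h (by linarith) (by linarith)
  · simpa using hε
  · rw [dist_eq_norm]
    exact h3 t s ht h (by linarith) (by linarith)

/-- The semigroup with generator `-A` is unique: on the domain of `A` two such semigroups differ by a
solution of `w' = -A w` with `w 0 = 0`. -/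
theorem IsAdmissibleContour.eq_semigroup (h : IsAdmissibleContour B μ τ M)
    (hB : ∀ y, 0 ≤ (inner ℂ (B y) y).re) (hd : DenseRange B)
    (hAB : ∀ x y, (x, y) ∈ A.graph ↔ x = B y) {S : ℝ → X →L[ℂ] X}
    (hS : A.IsSemigroupGeneratedByNeg S) {t : ℝ} (ht : 0 ≤ t) : S t = semigroup B μ τ t := by
  have hinc : ∀ y r, 0 ≤ r → Tendsto (fun u : ℝ => (u⁻¹ : ℝ) • (S u (S r (B y)) - S r (B y)))
      (𝓝[>] 0) (𝓝 (-S r y)) := by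
    intro y r hr
    have h1 : Tendsto (fun u : ℝ => S r ((u⁻¹ : ℝ) • (S u (B y) - B y))) (𝓝[>] 0)
        (𝓝 (S r (-y))) :=
      ((S r).continuous.tendsto _).comp ((hS.generator (B y) y).1 ((hAB _ _).2 rfl))
    rw [map_neg] at h1
    refine h1.congr' (eventually_nhdsWithin_of_forall fun u hu => ?_)
    have hu : 0 < u := hu
    have e : S r (S u (B y)) = S u (S r (B y)) := by
      have := (hS.map_add r u hr hu.le).symm.trans
        ((congrArg S (add_comm r u)).trans (hS.map_add u r hu.le hr))
      exact congrArg (fun T : X →L[ℂ] X => T (B y)) this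
    have e2 : S r ((u⁻¹ : ℝ) • (S u (B y) - B y)) = (u⁻¹ : ℝ) • S r (S u (B y) - B y) :=
      ((S r).restrictScalars ℝ).map_smul _ _
    rw [e2, map_sub, e]
  have hder : ∀ y r, 0 ≤ r → HasDerivWithinAt (fun r => S r (B y)) (-S r y) (Ici r) r := by
    intro y r hr
    rw [hasDerivWithinAt_iff_tendsto_slope, Ici_sdiff_left]
    have h2 : Tendsto (fun s : ℝ => s - r) (𝓝[>] r) (𝓝[>] 0) := by
      refine tendsto_nhdsWithin_iff.2 ⟨?_, eventually_nhdsWithin_of_forall fun s hs =>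
        mem_Ioi.2 (sub_pos.2 (mem_Ioi.1 hs))⟩
      have : Continuous fun s : ℝ => s - r := by fun_prop
      simpa using (this.tendsto r).mono_left nhdsWithin_le_nhds
    refine ((hinc y r hr).comp h2).congr' (eventually_nhdsWithin_of_forall fun s hs => ?_)
    have hs : r < s := hs
    rw [slope_def_module, Function.comp_apply]
    conv_rhs => rw [show s = (s - r) + r by ring, hS.map_add _ _ (by linarith) hr]
    rw [sub_add_cancel]
    rfl
  have hcomm : ∀ y r, 0 ≤ r → S r (B y) = B (S r y) := fun y r hr =>
    (hAB _ _).1 ((hS.generator _ _).2 (hinc y r hr))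
  have hrange : ∀ y, S t (B y) = semigroup B μ τ t (B y) := by
    intro y
    have key := norm_le_of_hasDerivWithinAt hB
      (w := fun r => S r (B y) - semigroup B μ τ r (B y))
      (v := fun r => S r y - semigroup B μ τ r y) ht ?_ ?_ ?_
    · simp only [hS.map_zero, semigroup_zero] at key
      rw [show (1 : X →L[ℂ] X) (B y) = ContinuousLinearMap.id ℂ X (B y) from rfl, sub_self,
        norm_zero] at key
      exact sub_eq_zero.1 (norm_le_zero_iff.1 key)
    · exact ((continuousOn_of_isSemigroupGeneratedByNeg hS _).mono fun r hr => hr.1).sub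
        ((h.continuousOn_semigroup hB hd _).mono fun r hr => hr.1)
    · intro r hr
      refine ((hder y r hr.1).sub
        (h.hasDerivWithinAt_semigroup_apply hB hd y hr.1)).congr_deriv ?_
      abel
    · intro r hr
      rw [map_sub, h.apply_semigroup, hcomm y r hr.1]
  ext x
  exact congrFun (hd.equalizer (S t).continuous (semigroup B μ τ t).continuous
    (funext hrange)) x

end Semigroup

/-! ### The resolvent as a Laplace transform -/

section Laplace

variable {X : Type*} [NormedAddCommGroup X] [InnerProductSpace ℂ X] [CompleteSpace X]
variable {B : X →L[ℂ] X} {μ τ M : ℝ}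

theorem norm_exp_smul (z : ℂ) (t : ℝ) (S : X →L[ℂ] X) :
    ‖Complex.exp (z * t) • S‖ = Real.exp (z.re * t) * ‖S‖ := by
  rw [norm_smul, Complex.norm_exp, Complex.re_mul_ofReal]

/-- The resolvent is the Laplace transform of the semigroup: with
`Q = ∫ exp (z t) e^{-tA} dt`, integrating the derivative of `exp (z t) e^{-tA} A⁻¹` gives
`Q (1 - z A⁻¹) = A⁻¹`. -/
theorem IsAdmissibleContour.invRes_eq_integral (h : IsAdmissibleContour B μ τ M) {C ω : ℝ}
    (hC : ∀ t : ℝ, 0 < t → ‖semigroup B μ τ t‖ ≤ C * Real.exp (-ω * t)) {z : ℂ} (hz : z.re < ω) :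
    z ∈ invResSet B ∧
      IntegrableOn (fun t : ℝ => Complex.exp (z * t) • semigroup B μ τ t) (Ioi 0) ∧
      invRes B z = ∫ t in Ioi (0 : ℝ), Complex.exp (z * t) • semigroup B μ τ t := by
  have hneg : z.re - ω < 0 := by linarith
  have hbound : ∀ t : ℝ, 0 < t → ‖Complex.exp (z * t) • semigroup B μ τ t‖
      ≤ C * Real.exp ((z.re - ω) * t) := by
    intro t ht
    rw [norm_exp_smul, sub_mul, sub_eq_add_neg, Real.exp_add, ← neg_mul]
    have := mul_le_mul_of_nonneg_left (hC t ht) (Real.exp_pos (z.re * t)).le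
    linarith
  have hderexp : ∀ t : ℝ, HasDerivAt (fun t : ℝ => Complex.exp (z * t))
      (z * Complex.exp (z * t)) t := fun t => by
    have h1 : HasDerivAt (fun t : ℝ => z * (t : ℂ)) (z * 1) t :=
      (Complex.ofRealCLM.hasDerivAt (x := t)).const_mul z
    simpa [mul_comm] using h1.cexp
  have hcont : ContinuousOn (fun t : ℝ => Complex.exp (z * t) • semigroup B μ τ t) (Ioi 0) :=
    fun t ht => ((hderexp t).continuousAt.smul
      (h.hasDerivAt_semigroup ht).continuousAt).continuousWithinAt
  have hint : IntegrableOn (fun t : ℝ => Complex.exp (z * t) • semigroup B μ τ t) (Ioi 0) := by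
    refine Integrable.mono' ((integrableOn_exp_mul_Ioi hneg 0).const_mul C)
      (hcont.aestronglyMeasurable measurableSet_Ioi) ?_
    exact (ae_restrict_iff' measurableSet_Ioi).2 (Eventually.of_forall fun t ht => hbound t ht)
  set Q : X →L[ℂ] X := ∫ t in Ioi (0 : ℝ), Complex.exp (z * t) • semigroup B μ τ t with hQ
  have hQ1 : Q * (1 - z • B) = B := by
    have hder : ∀ t ∈ Ioi (0 : ℝ), HasDerivAt
        (fun t : ℝ => Complex.exp (z * t) • (semigroup B μ τ t * B))
        (-((Complex.exp (z * t) • semigroup B μ τ t) * (1 - z • B))) t := by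
      intro t ht
      refine ((hderexp t).smul (h.hasDerivAt_semigroup_mul ht)).congr_deriv ?_
      rw [mul_sub, mul_one, mul_smul_comm, smul_mul_assoc]
      module
    have h0 : ContinuousWithinAt (fun t : ℝ => Complex.exp (z * t) • (semigroup B μ τ t * B))
        (Ici 0) 0 := by
      refine (hderexp 0).continuousAt.continuousWithinAt.smul ?_
      rw [← continuousWithinAt_Ioi_iff_Ici, ContinuousWithinAt, semigroup_zero, one_mul]
      exact h.tendsto_semigroup_mul
    have hlim : Tendsto (fun t : ℝ => Complex.exp (z * t) • (semigroup B μ τ t * B)) atTop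
        (𝓝 0) := by
      have h1 : Tendsto (fun t : ℝ => C * Real.exp ((z.re - ω) * t) * ‖B‖) atTop (𝓝 0) := by
        have : Tendsto (fun t : ℝ => Real.exp ((z.re - ω) * t)) atTop (𝓝 0) :=
          Real.tendsto_exp_atBot.comp (tendsto_id.const_mul_atTop_of_neg hneg)
        simpa using (this.const_mul C).mul_const ‖B‖
      refine squeeze_zero_norm' ?_ h1
      filter_upwards [eventually_gt_atTop 0] with t ht
      rw [← smul_mul_assoc]
      exact (norm_mul_le _ _).trans (mul_le_mul_of_nonneg_right (hbound t ht) (norm_nonneg _))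
    have h2 := integral_Ioi_of_hasDerivAt_of_tendsto h0 hder (hint.mul_const (1 - z • B)).neg hlim
    rw [integral_neg, integral_mul_const_of_integrable hint, semigroup_zero] at h2
    simpa using h2
  have hQB : B * Q = Q * B := by
    rw [hQ, ← integral_const_mul_of_integrable hint, ← integral_mul_const_of_integrable hint]
    congr 1
    funext t
    rw [mul_smul_comm, smul_mul_assoc, (h.commute_semigroup t).eq]
  have hQ2 : (1 - z • B) * Q = B := by
    rw [sub_mul, one_mul, smul_mul_assoc, hQB]
    rwa [mul_sub, mul_one, mul_smul_comm] at hQ1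
  have hmem := mem_invResSet_of_mul_eq hQ2 hQ1
  exact ⟨hmem, hint, (eq_invRes hmem hQ2).symm⟩

/-- On the imaginary axis one integrates the bound `min 1 (C exp (-ω t))` of the semigroup, which
changes at `t = log C / ω`. -/
theorem IsAdmissibleContour.norm_invRes_le_of_exp_bound (h : IsAdmissibleContour B μ τ M)
    (h1 : ∀ t : ℝ, 0 < t → ‖semigroup B μ τ t‖ ≤ 1) {C ω : ℝ} (hω : 0 < ω) (hC₁ : 1 ≤ C)
    (hC : ∀ t : ℝ, 0 < t → ‖semigroup B μ τ t‖ ≤ C * Real.exp (-ω * t)) {z : ℂ} (hz : z.re = 0) :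
    ‖invRes B z‖ ≤ (1 + Real.log C) / ω := by
  obtain ⟨-, hint, he⟩ := h.invRes_eq_integral hC (z := z) (by rwa [hz])
  have hn : ∀ t : ℝ, ‖Complex.exp (z * t) • semigroup B μ τ t‖ = ‖semigroup B μ τ t‖ := fun t => by
    rw [norm_exp_smul, hz]; simp
  set t₀ := Real.log C / ω with ht₀
  have ht₀0 : 0 ≤ t₀ := div_nonneg (Real.log_nonneg hC₁) hω.le
  have hneg : -ω < 0 := by linarith
  rw [he, ← Ioc_union_Ioi_eq_Ioi ht₀0, setIntegral_union (Ioc_disjoint_Ioi le_rfl) measurableSet_Ioi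
    (hint.mono_set Ioc_subset_Ioi_self) (hint.mono_set (Ioi_subset_Ioi ht₀0))]
  have e1 : ‖∫ t in Ioc (0 : ℝ) t₀, Complex.exp (z * t) • semigroup B μ τ t‖ ≤ t₀ := by
    have := norm_setIntegral_le_of_norm_le_const (μ := volume) (s := Ioc (0 : ℝ) t₀) (C := 1)
      (f := fun t : ℝ => Complex.exp (z * t) • semigroup B μ τ t) measure_Ioc_lt_top
      (fun t ht => by rw [hn]; exact h1 t ht.1)
    rwa [Real.volume_real_Ioc_of_le ht₀0, one_mul, sub_zero] at this
  have e2 : ‖∫ t in Ioi t₀, Complex.exp (z * t) • semigroup B μ τ t‖ ≤ 1 / ω := by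
    have := norm_integral_le_of_norm_le (μ := volume.restrict (Ioi t₀))
      (f := fun t : ℝ => Complex.exp (z * t) • semigroup B μ τ t)
      ((integrableOn_exp_mul_Ioi hneg t₀).const_mul C)
      ((ae_restrict_iff' measurableSet_Ioi).2 (Eventually.of_forall fun t ht => by
        rw [hn]; exact hC t (ht₀0.trans_lt ht)))
    rw [integral_const_mul, integral_exp_mul_Ioi hneg] at this
    refine this.trans_eq ?_
    have e3 : -ω * t₀ = -Real.log C := by rw [ht₀]; field_simp
    rw [e3, Real.exp_neg, Real.exp_log (by linarith)]
    field_simp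
  refine (norm_add_le _ _).trans ((add_le_add e1 e2).trans_eq ?_)
  rw [ht₀]
  ring

end Laplace

/-! ### Unbounded operators with a bounded inverse -/

section LinearPMap

variable {X : Type*} [NormedAddCommGroup X] [InnerProductSpace ℂ X]
variable {A : X →ₗ.[ℂ] X} {B : X →L[ℂ] X} {α : ℝ}

theorem mem_graph_iff_of_isResolventAt_zero (hB : A.IsResolventAt 0 B) (x y : X) :
    (x, y) ∈ A.graph ↔ x = B y := by
  rw [LinearPMap.mem_graph_iff]
  constructor
  · rintro ⟨u, rfl, rfl⟩
    simpa using (hB.left_inv u).symm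
  · rintro rfl
    obtain ⟨h, h'⟩ := hB.right_inv y
    exact ⟨⟨B y, h⟩, rfl, by simpa using h'⟩

/-- The resolvent of `A` at `z` in terms of the inverse `B` of `A`. -/
theorem isResolventAt_iff (hB : A.IsResolventAt 0 B) {z : ℂ} {R : X →L[ℂ] X} :
    A.IsResolventAt z R ↔ (1 - z • B) * R = B ∧ R * (1 - z • B) = B := by
  have hG := mem_graph_iff_of_isResolventAt_zero hB
  constructor
  · intro hR
    constructor
    · ext y
      obtain ⟨h, h'⟩ := hR.right_inv y
      have h1 := (hG (R y) (y + z • R y)).1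
        ((LinearPMap.mem_graph_iff A).2 ⟨⟨R y, h⟩, rfl, by rw [← sub_eq_iff_eq_add]; exact h'⟩)
      change R y - z • B (R y) = B y
      rw [map_add, map_smul] at h1
      rw [sub_eq_iff_eq_add]
      exact h1
    · ext y
      obtain ⟨h, h'⟩ := hB.right_inv y
      have h1 := hR.left_inv ⟨B y, h⟩
      rw [zero_smul, sub_zero] at h'
      rw [h'] at h1
      exact h1
  · rintro ⟨h₁, h₂⟩
    refine ⟨fun y => ?_, fun u => ?_⟩
    · have h1 : R y = B (y + z • R y) := by
        have := congrArg (fun T : X →L[ℂ] X => T y) h₁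
        change R y - z • B (R y) = B y at this
        rw [map_add, map_smul, ← sub_eq_iff_eq_add]
        exact this
      obtain ⟨u, hu, hu'⟩ := (LinearPMap.mem_graph_iff A).1 ((hG _ _).2 h1)
      have hmem : R y ∈ A.domain := (show (u : X) = R y from hu) ▸ u.2
      refine ⟨hmem, ?_⟩
      have : (⟨R y, hmem⟩ : A.domain) = u := Subtype.ext hu.symm
      rw [this, hu']
      simp
    · have hu := (hG _ _).1 (A.mem_graph u)
      have := congrArg (fun T : X →L[ℂ] X => T (A u)) h₂
      change R (A u - z • B (A u)) = B (A u) at this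
      rwa [← hu] at this

theorem resolventSet_eq (hB : A.IsResolventAt 0 B) : A.resolventSet = invResSet B := by
  ext z
  constructor
  · rintro ⟨R, hR⟩
    obtain ⟨h₁, h₂⟩ := (isResolventAt_iff hB).1 hR
    exact mem_invResSet_of_mul_eq h₁ h₂
  · intro hz
    exact ⟨invRes B z, (isResolventAt_iff hB).2 ⟨mul_invRes_cancel hz, invRes_mul_cancel hz⟩⟩

theorem resolventNorm_eq (hB : A.IsResolventAt 0 B) {z : ℂ} (hz : z ∈ invResSet B) :
    A.resolventNorm z = ‖invRes B z‖ₑ := by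
  have hz' : z ∈ A.resolventSet := by rwa [resolventSet_eq hB]
  have hex : ∃ R : X →L[ℂ] X, A.IsResolventAt z R := hz'
  rw [LinearPMap.resolventNorm, if_pos hz', LinearPMap.resolvent, dif_pos hex,
    eq_invRes hz ((isResolventAt_iff hB).1 hex.choose_spec).1]

theorem denseRange_of_isResolventAt_zero (hB : A.IsResolventAt 0 B)
    (hA : Dense (A.domain : Set X)) : DenseRange B := by
  refine hA.mono fun u hu => ⟨A ⟨u, hu⟩, ?_⟩
  simpa using hB.left_inv ⟨u, hu⟩

theorem isSectorialInverse_of_numericalRange (hB : A.IsResolventAt 0 B)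
    (hsector : A.numericalRange ⊆ {z : ℂ | |z.arg| ≤ Real.pi / 2 - 2 * α}) :
    IsSectorialInverse B α := by
  intro φ hφ y
  by_cases h0 : B y = 0
  · simp [h0]
  obtain ⟨hmem, hy⟩ := hB.right_inv y
  rw [zero_smul, sub_zero] at hy
  have hn : (‖B y‖ : ℂ) ≠ 0 := by exact_mod_cast norm_ne_zero_iff.2 h0
  set w : ℂ := inner ℂ ((‖B y‖ : ℂ)⁻¹ • B y) ((‖B y‖ : ℂ)⁻¹ • y) with hw
  have hwr : w ∈ A.numericalRange := by
    refine ⟨(‖B y‖ : ℂ)⁻¹ • ⟨B y, hmem⟩, ?_, ?_⟩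
    · change ‖(‖B y‖ : ℂ)⁻¹ • B y‖ = 1
      rw [norm_smul, norm_inv, Complex.norm_real, norm_norm,
        inv_mul_cancel₀ (norm_ne_zero_iff.2 h0)]
    · rw [LinearPMap.map_smul, hy]
      rfl
  have harg : |w.arg| ≤ Real.pi / 2 - 2 * α := hsector hwr
  have hq : inner ℂ (B y) y = ((‖B y‖ ^ 2 : ℝ) : ℂ) * w := by
    rw [hw, inner_smul_left, inner_smul_right, map_inv₀, Complex.conj_ofReal]
    push_cast
    field_simp
  have hcos : 0 ≤ Real.cos (φ + w.arg) := by
    have h1 := abs_le.1 hφ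
    have h2 := abs_le.1 harg
    exact Real.cos_nonneg_of_mem_Icc ⟨by linarith, by linarith⟩
  rw [hq, Complex.re_ofReal_mul, Complex.im_ofReal_mul, ← Complex.norm_mul_cos_arg w,
    ← Complex.norm_mul_sin_arg w]
  have : 0 ≤ ‖B y‖ ^ 2 * ‖w‖ * Real.cos (φ + w.arg) := by positivity
  rw [Real.cos_add] at this
  linarith

theorem mem_invResSet_of_re_le (hB : A.IsResolventAt 0 B) {μ : ℝ}
    (hμ : (μ : EReal) < A.spectralAbscissa) {z : ℂ} (hz : z.re ≤ μ) : z ∈ invResSet B := by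
  by_contra hcon
  have h1 : z ∈ A.spectrum := by
    rw [LinearPMap.spectrum, resolventSet_eq hB]; exact hcon
  have h2 : A.spectralAbscissa ≤ (z.re : EReal) := iInf₂_le z h1
  exact absurd (hμ.trans_le (h2.trans (EReal.coe_le_coe_iff.2 hz))) (lt_irrefl _)

theorem le_spectralAbscissa (hB : A.IsResolventAt 0 B) {μ : ℝ}
    (h : ∀ z, z.re < μ → z ∈ invResSet B) : (μ : EReal) ≤ A.spectralAbscissa := by
  refine le_iInf₂ fun z hz => EReal.coe_le_coe_iff.2 ?_
  by_contra! hlt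
  rw [LinearPMap.spectrum, resolventSet_eq hB] at hz
  exact hz (h z hlt)

variable [CompleteSpace X]

theorem IsSectorialInverse.exists_isAdmissibleContour (hB : IsSectorialInverse B α) (hα₀ : 0 < α)
    (hα₁ : α ≤ Real.pi / 4) {μ : ℝ} (hμ₀ : 0 < μ) (hμ : ∀ z : ℂ, z.re ≤ μ → z ∈ invResSet B) :
    ∃ M, IsAdmissibleContour B μ (Real.tan α) M := by
  obtain ⟨M, hM, hb⟩ := hB.exists_bound_leftRegion hα₀ hα₁ hμ₀ hμ
  exact ⟨M, hμ₀, Real.tan_pos_of_pos_of_lt_pi_div_two hα₀ (by linarith [Real.pi_pos]), hM,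
    hB.leftRegion_subset hα₀ hα₁ hμ₀ hμ, hb⟩

/-- The spectrum stays away from the imaginary axis: it lies in the sector `Re z ≥ tan α * |Im z|`
and does not meet a neighbourhood of `0`. -/
theorem IsSectorialInverse.exists_halfPlane_subset (hB : IsSectorialInverse B α) (hα₀ : 0 < α)
    (hα₁ : α ≤ Real.pi / 4) : ∃ δ : ℝ, 0 < δ ∧ ∀ z : ℂ, z.re < δ → z ∈ invResSet B := by
  have hτ : 0 < Real.tan α :=
    Real.tan_pos_of_pos_of_lt_pi_div_two hα₀ (by linarith [Real.pi_pos])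
  obtain ⟨r, hr, hball⟩ := Metric.isOpen_iff.1 (isOpen_invResSet B) 0 (zero_mem_invResSet B)
  refine ⟨r / (1 + 1 / Real.tan α), by positivity, fun z hz => ?_⟩
  by_contra hcon
  have h1 : Real.tan α * |z.im| ≤ z.re := by
    by_contra! hlt
    by_cases him : z.im = 0
    · refine hcon (hB.mem_invResSet (φ := 0) (by simpa using hα₀.le) ?_)
      simpa [him] using hlt
    · exact hcon (hB.resolvent_left_of_rays hα₀ hα₁ him hlt.le).1
  have h2 : r ≤ ‖z‖ := by
    by_contra! hlt
    exact hcon (hball (by simpa using hlt))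
  have h3 : ‖z‖ ≤ |z.re| + |z.im| := Complex.norm_le_abs_re_add_abs_im z
  have h4 : 0 ≤ z.re := le_trans (by positivity) h1
  rw [abs_of_nonneg h4] at h3
  have h5 : |z.im| ≤ z.re / Real.tan α := by rw [le_div_iff₀ hτ]; linarith
  rw [lt_div_iff₀ (by positivity)] at hz
  have h6 : z.re * (1 + 1 / Real.tan α) = z.re + z.re / Real.tan α := by ring
  linarith

theorem IsAdmissibleContour.lineResolventBound_ne_top {μ τ M : ℝ}
    (h : IsAdmissibleContour B μ τ M) (hB : A.IsResolventAt 0 B) {ν : ℝ} (hν : ν ≤ μ) :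
    A.lineResolventBound ν ≠ ⊤ := by
  refine ne_top_of_le_ne_top (b := ENNReal.ofReal M) ENNReal.ofReal_ne_top (iSup_le fun l => ?_)
  have hmem : (ν : ℂ) + Complex.I * l ∈ leftRegion μ τ := by
    have : ((ν : ℂ) + Complex.I * l).re ≤ max μ (τ * |((ν : ℂ) + Complex.I * l).im|) := by
      refine le_max_of_le_left ?_
      simpa using hν
    exact this
  rw [resolventNorm_eq hB (h.subset hmem), ← ofReal_norm]
  refine ENNReal.ofReal_le_ofReal ((h.norm_le _ hmem).trans (div_le_self h.bound_nonneg ?_))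
  linarith [abs_nonneg ((ν : ℂ) + Complex.I * l).im]

theorem norm_invRes_le_lineResolventBound (hB : A.IsResolventAt 0 B) {ν : ℝ}
    (hν : ∀ z : ℂ, z.re ≤ ν → z ∈ invResSet B) (htop : A.lineResolventBound ν ≠ ⊤) (l : ℝ) :
    ‖invRes B ((ν : ℂ) + Complex.I * l)‖ ≤ (A.lineResolventBound ν).toReal := by
  have hmem : (ν : ℂ) + Complex.I * l ∈ invResSet B := hν _ (by simp)
  rw [← toReal_enorm, ← resolventNorm_eq hB hmem]
  exact ENNReal.toReal_mono htop (le_iSup (fun l : ℝ => A.resolventNorm ((ν : ℂ) + Complex.I * l)) l)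

/-- The exponential bound of the semigroup in terms of the resolvent on the line `Re z = μ`. The
contour integral gives it for `μ t ≥ 1 / 2`; for smaller `t` the constant is at least `2`, and the
contraction bound suffices. -/
theorem IsAdmissibleContour.norm_semigroup_le {μ M : ℝ} (hS : IsSectorialInverse B α)
    (hα₀ : 0 < α) (hα₁ : α ≤ Real.pi / 4) (h : IsAdmissibleContour B μ (Real.tan α) M)
    (hd : DenseRange B) {N : ℝ} (hN : ∀ y : ℝ, ‖invRes B ((μ : ℂ) + Complex.I * y)‖ ≤ N)
    {t : ℝ} (ht : 0 ≤ t) :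
    ‖semigroup B μ (Real.tan α) t‖
      ≤ 1 / (Real.pi * Real.tan α) * (μ * N + 2 * Real.pi) * Real.exp (-μ * t) := by
  have hτ := h.tau_pos
  have hμ := h.mu_pos
  have hτ1 : Real.tan α ≤ 1 := by
    rw [← Real.tan_pi_div_four]
    rcases hα₁.eq_or_lt with he | hlt
    · rw [he]
    · exact (Real.tan_lt_tan_of_lt_of_lt_pi_div_two (by linarith [Real.pi_pos])
        (by linarith [Real.pi_pos]) hlt).le
  have hpi := Real.pi_gt_three
  have hN0 : 0 ≤ N := (norm_nonneg _).trans (hN 0)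
  set τ := Real.tan α with hτdef
  by_cases hsmall : μ * t < 1 / 2
  · refine (h.norm_semigroup_le_one (hS.re_inner_nonneg hα₀.le) hd ht).trans ?_
    have h1 : 1 / 2 ≤ Real.exp (-μ * t) := by
      have := Real.add_one_le_exp (-μ * t)
      linarith
    have h2 : 2 ≤ 1 / (Real.pi * τ) * (μ * N + 2 * Real.pi) := by
      rw [one_div, inv_mul_eq_div, le_div_iff₀ (by positivity)]
      have : Real.pi * τ ≤ Real.pi * 1 := by gcongr
      have := mul_nonneg hμ.le hN0
      linarith
    have := mul_le_mul h2 h1 (by norm_num) (by linarith)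
    linarith
  · push Not at hsmall
    have htpos : 0 < t := by
      rcases ht.eq_or_lt with rfl | h'
      · norm_num at hsmall
      · exact h'
    rw [semigroup_of_pos htpos]
    refine (h.norm_semigroupIntegral_le (N := N) (fun y hy => ?_) (fun y hy => ?_) htpos).trans ?_
    · have e : contour μ τ y = (μ : ℂ) + Complex.I * y := by
        rw [contour, max_eq_left (by rw [le_div_iff₀ hτ] at hy; linarith), mul_comm Complex.I]
      rw [e]
      exact hN y
    · have hy0 : y ≠ 0 := by
        rintro rfl
        simp at hy
        linarith
      have := (hS.resolvent_left_of_rays hα₀ hα₁ (z := contour μ τ y) (by simpa using hy0)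
        (by simp [← hτdef, hy])).2
      simpa only [contour_im] using this
    · gcongr
      have h3 : Real.sqrt (1 + τ ^ 2) ≤ 2 := by
        rw [Real.sqrt_le_left (by norm_num)]
        nlinarith
      rw [div_le_iff₀ (by positivity)]
      nlinarith

/-- Moving the line by `μ < 1 / K`, where `K` bounds the resolvent on the imaginary axis, changes
the bound to `K / (1 - μ K)`. The case `K = 0` is that of the trivial space. -/
theorem lineResolventBound_le_of_lt_pseudospectralAbscissa (hB : A.IsResolventAt 0 B)
    (h0 : ∀ z : ℂ, z.re ≤ 0 → z ∈ invResSet B) {μ : ℝ} (hμ₀ : 0 < μ)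
    (hμ : ENNReal.ofReal μ < A.pseudospectralAbscissa) :
    A.lineResolventBound μ ≤ (A.pseudospectralAbscissa - ENNReal.ofReal μ)⁻¹ := by
  rw [LinearPMap.pseudospectralAbscissa] at hμ ⊢
  set S : ℝ≥0∞ := ⨆ l : ℝ, A.resolventNorm (Complex.I * (l : ℂ)) with hSdef
  have hStop : S ≠ ⊤ := by
    rintro hS
    rw [hS, ENNReal.inv_top] at hμ
    exact not_lt_bot hμ
  set K := S.toReal with hK
  have hSK : S = ENNReal.ofReal K := (ENNReal.ofReal_toReal hStop).symm
  have hK0 : 0 ≤ K := ENNReal.toReal_nonneg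
  have hKb : ∀ l : ℝ, ‖invRes B (Complex.I * l)‖ ≤ K := fun l => by
    have hmem : Complex.I * (l : ℂ) ∈ invResSet B := h0 _ (by simp)
    rw [← toReal_enorm, ← resolventNorm_eq hB hmem]
    exact ENNReal.toReal_mono hStop (le_iSup (fun l : ℝ => A.resolventNorm (Complex.I * l)) l)
  have hμK : μ * K < 1 := by
    rcases hK0.eq_or_lt with hz | hpos
    · rw [← hz]; simp
    · rw [hSK, ← ENNReal.ofReal_inv_of_pos hpos, ENNReal.ofReal_lt_ofReal_iff (by positivity),
        lt_inv_comm₀ hμ₀ hpos, ← one_div, lt_div_iff₀ hμ₀] at hμ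
      linarith
  have hval : ENNReal.ofReal (K / (1 - μ * K)) ≤ (S⁻¹ - ENNReal.ofReal μ)⁻¹ := by
    rcases hK0.eq_or_lt with hz | hpos
    · rw [← hz]; simp
    · have h1 : 0 < K⁻¹ - μ := by
        rw [sub_pos, ← one_div, lt_div_iff₀ hpos]; exact hμK
      rw [hSK, ← ENNReal.ofReal_inv_of_pos hpos, ← ENNReal.ofReal_sub _ hμ₀.le,
        ← ENNReal.ofReal_inv_of_pos h1]
      refine ENNReal.ofReal_le_ofReal (le_of_eq ?_)
      have h2 : 1 - μ * K ≠ 0 := by linarith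
      have h3 : K⁻¹ - μ = (1 - μ * K) / K := by field_simp
      rw [h3, inv_div]
  refine iSup_le fun l => le_trans ?_ hval
  have hmem : Complex.I * (l : ℂ) ∈ invResSet B := h0 _ (by simp)
  have hw : ‖((μ : ℂ) + Complex.I * l) - Complex.I * l‖ = μ := by
    rw [add_sub_cancel_right, Complex.norm_real, Real.norm_of_nonneg hμ₀.le]
  obtain ⟨h1, h2⟩ := norm_invRes_le_of_near hmem (hKb l) (w := (μ : ℂ) + Complex.I * l)
    (by rw [hw]; exact hμK)
  rw [hw] at h2
  rw [resolventNorm_eq hB h1, ← ofReal_norm]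
  exact ENNReal.ofReal_le_ofReal h2

end LinearPMap

end SectorialSemigroup

theorem lemma1 {X : Type*} [NormedAddCommGroup X] [InnerProductSpace ℂ X] [CompleteSpace X]
    (A : X →ₗ.[ℂ] X) (hA : A.IsMaximalAccretive)
    (α : ℝ) (hα₀ : 0 < α) (hα₁ : α ≤ Real.pi / 4)
    (hsector : A.numericalRange ⊆ {z : ℂ | |z.arg| ≤ Real.pi / 2 - 2 * α})
    (hinv : (0 : ℂ) ∈ A.resolventSet) :
    -- the objects in the claim are meaningful
    A.IsSemigroupGeneratedByNeg A.expNeg ∧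
    0 < A.spectralAbscissa ∧
    0 < A.pseudospectralAbscissa ∧
    -- (i)
    (∀ C μ : ℝ, 1 ≤ C → 0 < μ →
      (∀ t : ℝ, 0 ≤ t → ‖A.expNeg t‖ ≤ C * Real.exp (-μ * t)) →
      (μ : EReal) ≤ A.spectralAbscissa ∧
      ENNReal.ofReal (μ / (1 + Real.log C)) ≤ A.pseudospectralAbscissa) ∧
    -- (ii)
    (∀ μ : ℝ, 0 < μ → (μ : EReal) < A.spectralAbscissa →
      A.lineResolventBound μ ≠ ⊤ ∧
      ∀ t : ℝ, 0 ≤ t →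
        ‖A.expNeg t‖ ≤
          1 / (Real.pi * Real.tan α) * (μ * (A.lineResolventBound μ).toReal + 2 * Real.pi) *
            Real.exp (-μ * t)) ∧
    -- (iii)
    (∀ μ : ℝ, 0 < μ → ENNReal.ofReal μ < A.pseudospectralAbscissa →
      A.lineResolventBound μ ≤ (A.pseudospectralAbscissa - ENNReal.ofReal μ)⁻¹) := by
  open SectorialSemigroup in
  obtain ⟨B, hB⟩ := hinv
  have hS : IsSectorialInverse B α := isSectorialInverse_of_numericalRange hB hsector
  have hacc := hS.re_inner_nonneg hα₀.le
  have hAB := mem_graph_iff_of_isResolventAt_zero hB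
  have hd := denseRange_of_isResolventAt_zero hB hA.dense_domain
  obtain ⟨δ, hδ, hhalf⟩ := hS.exists_halfPlane_subset hα₀ hα₁
  have h0 : ∀ z : ℂ, z.re ≤ 0 → z ∈ invResSet B := fun z hz => hhalf z (by linarith)
  obtain ⟨M₀, hadm⟩ := hS.exists_isAdmissibleContour hα₀ hα₁ (half_pos hδ)
    fun z hz => hhalf z (by linarith)
  have hex : ∃ T : ℝ → X →L[ℂ] X, A.IsSemigroupGeneratedByNeg T :=
    ⟨_, hadm.isSemigroupGeneratedByNeg hacc hd hAB⟩
  have hgen : A.IsSemigroupGeneratedByNeg A.expNeg := by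
    have he : A.expNeg = hex.choose := by
      funext t
      rw [LinearPMap.expNeg, dif_pos hex]
    rw [he]
    exact hex.choose_spec
  have hline : A.pseudospectralAbscissa = (A.lineResolventBound 0)⁻¹ := by
    simp [LinearPMap.pseudospectralAbscissa, LinearPMap.lineResolventBound]
  refine ⟨hgen, ?_, ?_, fun C μ hC₁ hμ hC => ?_, fun μ hμ₀ hμ => ?_, fun μ hμ₀ hμ =>
    lineResolventBound_le_of_lt_pseudospectralAbscissa hB h0 hμ₀ hμ⟩
  · exact (EReal.coe_pos.2 hδ).trans_le (le_spectralAbscissa hB hhalf)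
  · rw [hline]
    exact ENNReal.inv_pos.2 (hadm.lineResolventBound_ne_top hB (half_pos hδ).le)
  · have hC' : ∀ t : ℝ, 0 < t → ‖semigroup B (δ / 2) (Real.tan α) t‖ ≤ C * Real.exp (-μ * t) := by
      intro t ht
      rw [← hadm.eq_semigroup hacc hd hAB hgen ht.le]
      exact hC t ht.le
    refine ⟨le_spectralAbscissa hB fun z hz => (hadm.invRes_eq_integral hC' hz).1, ?_⟩
    have hlog : 0 < 1 + Real.log C := by linarith [Real.log_nonneg hC₁]
    rw [LinearPMap.pseudospectralAbscissa, ENNReal.le_inv_iff_le_inv,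
      ← ENNReal.ofReal_inv_of_pos (by positivity), inv_div]
    refine iSup_le fun l => ?_
    rw [resolventNorm_eq hB (h0 _ (by simp)), ← ofReal_norm]
    exact ENNReal.ofReal_le_ofReal (hadm.norm_invRes_le_of_exp_bound
      (fun t ht => hadm.norm_semigroup_le_one hacc hd ht.le) hμ hC₁ hC' (by simp))
  · have hre : ∀ z : ℂ, z.re ≤ μ → z ∈ invResSet B := fun z hz => mem_invResSet_of_re_le hB hμ hz
    obtain ⟨M, hadm'⟩ := hS.exists_isAdmissibleContour hα₀ hα₁ hμ₀ hre
    have htop := hadm'.lineResolventBound_ne_top hB le_rfl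
    refine ⟨htop, fun t ht => ?_⟩
    rw [hadm'.eq_semigroup hacc hd hAB hgen ht]
    exact IsAdmissibleContour.norm_semigroup_le hS hα₀ hα₁ hadm' hd
      (norm_invRes_le_lineResolventBound hB hre htop) ht
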